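/- Let $X$ be a smooth connected compact complex curve, $\omega$ a nonzero meromorphic differential on $X$, $S\subset X$ a finite set containing all zeros and poles of $\omega$, and $z_s$ a local coordinate at each $s\in S$. Put $\mathcal K=\bigoplus_{s\in S}\mathcal K_s$ with $\mathcal K_s=\mathbb C((z_s))$ the local field at $s$, $\mathcal O=\bigoplus_s\mathbb C[[z_s]]$, $\langle f,g\rangle=\sum_{s\in S}\operatorname{res}_s(fg\omega)$ and $\partial f=df/\omega$ on $\mathcal K$. Let $R\subset\mathcal K$ be the ring of meromorphic functions on $X$ regular outside $S$ (embedded by Laurent expansion), let $\Lambda\subset\mathcal K$ be a Lagrangian complement of $R$ commensurable with $\mathcal O$, and let $(e^i)_{i\in\mathbb N}$, $(e_i)_{i\in\mathbb N}$ be dual bases of $R$ and $\Lambda$, $\langle e^i,e_j\rangle=\delta_{ij}$, with $e_i\to0$. Let $$G=-\sum_i e^i\otimes e_i ,\qquad \gamma=(\partial\otimes1)G-G^2 ,$$ with components $G_{s,t},\gamma_{s,t}\in\mathbb C((z_s))((w_t))$ for $s,t\in S$. Let $\psi\in\hbar\,\mathbb C[\gamma_0,\gamma_1,\dots][[\hbar]]$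 be the unique solution, vanishing at $\hbar=0$, of $$\frac{\partial\psi}{\partial\hbar}=D\psi-1-\gamma_0\psi^2,\qquad D=\sum_{j\ge0}\gamma_{j+1}\frac{\partial}{\partial\gamma_j},$$ and let $\psi(\hbar,(\partial^j\otimes1)\gamma)$ be obtained from it by substituting $(\partial^j\otimes1)\gamma$ for $\gamma_j$. Write $\mathbb C((z_s,w_t))=\mathbb C[[z_s,w_t]][z_s^{-1},w_t^{-1}]\subset\mathbb C((z_s))((w_t))$ and $q^{-\partial}=e^{-\hbar\partial}=\sum_k\frac{(-\hbar)^k}{k!}\partial^k$. Then there is $i=(i_{s,t})_{s,t\in S}\in 1+\hbar\bigoplus_{s,t\in S}\mathbb C((z_s,w_t))[[\hbar]]$ such that, near the diagonal, that is for all $s\in S$, $$z_s-q^{-\partial}w_s=i_{s,s}\cdot\Big[z_s-w_s+(z_s-w_s)\,G_{s,s}\,\psi\big(\hbar,(\partial^j\otimes1)\gamma_{s,s}\big)\Big]\quad\text{in }\mathbb C((z_s))((w_s))[[\hbar]],$$ while away from the diagonal, that is for $s\ne t$ in $S$, already $1=i_{s,t}\cdot\big[1+G_{s,t}\,\psi(\hbar,(\partial^j\otimes1)\gamma_{s,t})\big]$.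 -/

import Mathlib

open scoped Manifold ContDiff

noncomputable section

namespace GreenKernel

/-- The field `F((x))` of Laurent series over a field `F`. -/
abbrev Laurent (F : Type*) [Field F] : Type _ := LaurentSeries F

/-! ### Compact complex curves with a meromorphic differential and marked points -/

/-- `L` is the Laurent expansion at `0` of the function `f` of one complex variable (so that
`f` is meromorphic at `0`); the value of `f` at `0` plays no role. -/
def HasLaurentExpansion (f : ℂ → ℂ) (L : Laurent ℂ) : Prop :=
  ∀ᶠ x in nhdsWithin (0 : ℂ) {0}ᶜ, HasSum (fun n : ℤ => L.coeff n * x ^ n) (f x)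

theorem HasLaurentExpansion.add {f g : ℂ → ℂ} {L M : Laurent ℂ}
    (hf : HasLaurentExpansion f L) (hg : HasLaurentExpansion g M) :
    HasLaurentExpansion (fun x => f x + g x) (L + M) := by
  filter_upwards [hf, hg] with x h1 h2
  simpa [add_mul] using h1.add h2

theorem HasLaurentExpansion.const_mul {f : ℂ → ℂ} {L : Laurent ℂ} (c : ℂ)
    (hf : HasLaurentExpansion f L) : HasLaurentExpansion (fun x => c * f x) (c • L) := by
  filter_upwards [hf] with x h1
  simpa [mul_assoc] using h1.mul_left c

theorem HasLaurentExpansion.zero : HasLaurentExpansion (fun _ => 0) 0 := by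
  refine Filter.Eventually.of_forall fun x => ?_
  simp [hasSum_zero]

section Curve

variable {X : Type*} [TopologicalSpace X] [ChartedSpace ℂ X]

/-- The coefficient `g` in the expression `η = g(x) dx` of a `1`-form `η` of type `(1,0)` in a
holomorphic chart `φ` with coordinate `x`. -/
def localCoeff (η : (p : X) → (TangentSpace 𝓘(ℂ) p →L[ℂ] ℂ))
    (φ : OpenPartialHomeomorph X ℂ) (x : ℂ) : ℂ :=
  η (φ.symm x) (mfderiv 𝓘(ℂ) 𝓘(ℂ) φ.symm x (1 : ℂ))

variable (X) in
/-- A nonzero meromorphic differential on the complex curve `X`, a finite set `S` of points of `X`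
containing all its zeros and poles, and a local coordinate at each point of `S`.
The differential is a section of the cotangent bundle; its values at the points of `S` are
irrelevant. -/
structure MarkedCurve [IsManifold 𝓘(ℂ) ω X] where
  /-- the marked points -/
  S : Finset X
  /-- the differential -/
  form : (p : X) → (TangentSpace 𝓘(ℂ) p →L[ℂ] ℂ)
  /-- off `S`, the differential is holomorphic and does not vanish -/
  form_regular : ∀ p ∉ S, ∀ φ ∈ IsManifold.maximalAtlas 𝓘(ℂ) ω X, p ∈ φ.source →
    AnalyticAt ℂ (localCoeff form φ) (φ p) ∧ localCoeff form φ (φ p) ≠ 0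
  /-- the local coordinate `z_s` at `s` -/
  coord : S → OpenPartialHomeomorph X ℂ
  coord_mem : ∀ s, coord s ∈ IsManifold.maximalAtlas 𝓘(ℂ) ω X
  mem_source : ∀ s : S, (s : X) ∈ (coord s).source
  coord_self : ∀ s : S, coord s (s : X) = 0
  /-- the differential is meromorphic at the points of `S` -/
  form_meromorphic : ∀ s, ∃ L, HasLaurentExpansion (localCoeff form (coord s)) L

namespace MarkedCurve

variable [IsManifold 𝓘(ℂ) ω X] (C : MarkedCurve X)

/-- The Laurent series `ω_s` such that the differential is `ω_s(z_s) dz_s` near `s`. -/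
def formSeries (s : C.S) : Laurent ℂ := (C.form_meromorphic s).choose

/-- `𝒦 = ⊕_{s ∈ S} 𝒦_s`, where the local field `𝒦_s` is identified with `ℂ((z_s))`. -/
abbrev K : Type _ := C.S → Laurent ℂ

/-- `𝒪 = ⊕_{s ∈ S} ℂ[[z_s]]`. -/
def O : Submodule ℂ C.K where
  carrier := {f | ∀ s, ∀ n < (0 : ℤ), (f s).coeff n = 0}
  zero_mem' := by intro s n _; simp
  add_mem' := by
    intro f g hf hg s n hn
    simp [hf s n hn, hg s n hn]
  smul_mem' := by
    intro c f hf s n hn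
    simp [hf s n hn]

/-- The meromorphic functions on `X` that are regular outside `S`, embedded in `𝒦` by
Laurent expansion at the points of `S`. -/
def R : Submodule ℂ C.K where
  carrier := {L | ∃ f : X → ℂ, MDifferentiableOn 𝓘(ℂ) 𝓘(ℂ) f (C.S : Set X)ᶜ ∧
    ∀ s, HasLaurentExpansion (fun x => f ((C.coord s).symm x)) (L s)}
  zero_mem' := ⟨fun _ => 0, mdifferentiableOn_const, fun _ => HasLaurentExpansion.zero⟩
  add_mem' := by
    rintro L M ⟨f, hf, hL⟩ ⟨g, hg, hM⟩
    exact ⟨fun x => f x + g x, hf.add hg, fun s => (hL s).add (hM s)⟩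
  smul_mem' := by
    rintro c L ⟨f, hf, hL⟩
    exact ⟨fun x => c * f x, hf.const_smul c, fun s => (hL s).const_mul c⟩

/-- The bilinear form `⟨f, g⟩ = ∑_{s ∈ S} res_s (f g ω)` on `𝒦`. -/
def pairing (f g : C.K) : ℂ := ∑ s, (f s * g s * C.formSeries s).coeff (-1)

/-- The derivation `∂f = df / ω` of `ℂ((z_s))`. -/
def del (s : C.S) : Laurent ℂ →+ Laurent ℂ :=
  (AddMonoidHom.mulLeft (C.formSeries s)⁻¹).comp (LaurentSeries.derivative ℂ).toAddMonoidHom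

/-- `Λ` is a Lagrangian complement of `R` in `𝒦`, commensurable with `𝒪`. -/
structure IsLagrangianComplement (Λ : Submodule ℂ C.K) : Prop where
  isCompl : IsCompl C.R Λ
  lagrangian : ∀ x, x ∈ Λ ↔ ∀ y ∈ Λ, C.pairing x y = 0
  finite_quotient : FiniteDimensional ℂ (Λ ⧸ C.O.submoduleOf Λ)
  finite_quotient' : FiniteDimensional ℂ (C.O ⧸ Λ.submoduleOf C.O)

/-- Dual bases `(e^i)` of `R` and `(e_i)` of `Λ`, such that `e_i → 0` in the formal series
topology of `𝒦`. When `Λ` is a Lagrangian complement of `R`, it follows that every `λ ∈ Λ` is the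
sum of the convergent series `∑ ⟨e^i, λ⟩ e_i`. -/
structure DualBases (Λ : Submodule ℂ C.K) where
  /-- the basis `(e^i)` of `R` -/
  up : Module.Basis ℕ ℂ C.R
  /-- the dual family `(e_i)` in `Λ` -/
  down : ℕ → Λ
  dual : ∀ i j, C.pairing (up i) (down j) = if i = j then 1 else 0
  tendsto_zero : ∀ N : ℤ, ∀ᶠ i in Filter.atTop, ∀ s, ∀ n < N, ((down i : C.K) s).coeff n = 0

end MarkedCurve

end Curve

/-! ### Two-variable Laurent series -/

/-- `ℂ((z))((w))`: the outer variable is `w`, the coefficients are Laurent series in `z`. -/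
abbrev Laurent₂ : Type := Laurent (Laurent ℂ)

/-- `f ↦ f ⊗ 1 = f(z)`. -/
def inZ (f : Laurent ℂ) : Laurent₂ := HahnSeries.C f

/-- `g ↦ 1 ⊗ g = g(w)`. -/
def inW (g : Laurent ℂ) : Laurent₂ := g.map (HahnSeries.C : ℂ →+* Laurent ℂ)

/-- The subset `ℂ((z, w)) = ℂ[[z, w]][z⁻¹, w⁻¹]` of `ℂ((z))((w))`: the series
`∑ a_{n,m} z^n w^m` for which both `n` and `m` are bounded below. -/
def boundedLaurent₂ : Set Laurent₂ :=
  {f | ∃ N : ℤ, ∀ m n : ℤ, n < N → (f.coeff m).coeff n = 0}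

/-- The local coordinate, as an element of `ℂ((z))`. -/
def localVar : Laurent ℂ := HahnSeries.single 1 1

/-! ### The universal series `ψ` -/

/-- The derivation `D = ∑ γ_{i+1} ∂/∂γ_i` of `ℂ[γ_0, γ_1, …]`. -/
def shiftDer : Derivation ℂ (MvPolynomial ℕ ℂ) (MvPolynomial ℕ ℂ) :=
  MvPolynomial.mkDerivation ℂ fun i => MvPolynomial.X (i + 1)

/-- The coefficients of `ψ`, obtained by solving `∂ψ/∂ħ = Dψ - 1 - γ_0 ψ²`, `ψ(0) = 0`,
recursively. -/
def psiCoeff : ℕ → MvPolynomial ℕ ℂ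
  | 0 => 0
  | n + 1 => MvPolynomial.C ((n + 1 : ℂ)⁻¹) *
      (shiftDer (psiCoeff n) - (if n = 0 then 1 else 0)
        - MvPolynomial.X 0 * ∑ k : Fin (n + 1), psiCoeff k * psiCoeff (n - k))
  decreasing_by all_goals omega

/-- The series `ψ ∈ ħ ℂ[γ_0, γ_1, …][[ħ]]`. -/
def psi : PowerSeries (MvPolynomial ℕ ℂ) := PowerSeries.mk psiCoeff

theorem constantCoeff_psi : PowerSeries.constantCoeff psi = 0 := by
  simp [psi, psiCoeff]

/-- The equation `∂ψ/∂ħ = Dψ - 1 - γ_0 ψ²`. -/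
theorem derivative_psi :
    PowerSeries.derivative (MvPolynomial ℕ ℂ) psi =
      PowerSeries.mk (fun n => shiftDer (PowerSeries.coeff n psi)) - 1
        - PowerSeries.C (MvPolynomial.X 0) * psi ^ 2 := by
  ext1 n
  have h : ((n : MvPolynomial ℕ ℂ) + 1) = MvPolynomial.C (n + 1 : ℂ) := by simp
  have h0 : (n + 1 : ℂ) ≠ 0 := Nat.cast_add_one_ne_zero n
  have hs : ∑ k : Fin (n + 1), psiCoeff k * psiCoeff (n - k)
      = PowerSeries.coeff n (psi ^ 2) := by
    rw [pow_two, PowerSeries.coeff_mul, Finset.Nat.sum_antidiagonal_eq_sum_range_succ_mk,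
      Finset.sum_range]
    simp [psi]
  rw [PowerSeries.coeff_derivative, map_sub, map_sub, PowerSeries.coeff_C_mul, ← hs,
    PowerSeries.coeff_one, PowerSeries.coeff_mk]
  simp only [psi, PowerSeries.coeff_mk]
  rw [psiCoeff, h, mul_comm, ← mul_assoc, ← MvPolynomial.C_mul, mul_inv_cancel₀ h0]
  simp

/-! ### The Green kernel -/

namespace MarkedCurve

variable {X : Type*} [TopologicalSpace X] [ChartedSpace ℂ X] [IsManifold 𝓘(ℂ) ω X]
  (C : MarkedCurve X)

/-- The operator `∂ ⊗ 1` on `ℂ((z_s))((w_t))`. -/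
def delZ (s : C.S) (f : Laurent₂) : Laurent₂ := f.map (C.del s)

/-- The element `q^{-∂} w` of `ℂ((w_t))[[ħ]]`, where `q = e^ħ`. -/
def shiftedW (t : C.S) : PowerSeries Laurent₂ :=
  PowerSeries.mk fun k => inW (((-1 : ℂ) ^ k / (k.factorial : ℂ)) • ((C.del t)^[k] localVar))

namespace DualBases

variable {C} {Λ : Submodule ℂ C.K} (B : C.DualBases Λ)

theorem green_bddBelow (s t : C.S) :
    BddBelow (Function.support fun m : ℤ =>
      -∑ᶠ i, ((B.down i : C.K) t).coeff m • ((B.up i : C.R) : C.K) s) := by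
  obtain ⟨I, hI⟩ := Filter.eventually_atTop.1 (B.tendsto_zero 0)
  have h1 : ∀ J : ℕ, ∃ N : ℤ, N ≤ 0 ∧ ∀ i < J, ∀ m < N, ((B.down i : C.K) t).coeff m = 0 := by
    intro J
    induction J with
    | zero => exact ⟨0, le_rfl, fun i hi => absurd hi (Nat.not_lt_zero i)⟩
    | succ J ih =>
      obtain ⟨N, hN, h⟩ := ih
      refine ⟨min N ((B.down J : C.K) t).order, (min_le_left _ _).trans hN, fun i hi m hm => ?_⟩
      rcases Nat.lt_succ_iff_lt_or_eq.1 hi with hi | rfl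
      · exact h i hi m (hm.trans_le (min_le_left _ _))
      · exact HahnSeries.coeff_eq_zero_of_lt_order (hm.trans_le (min_le_right _ _))
  obtain ⟨N, hN, h⟩ := h1 I
  refine ⟨N, fun m hm => ?_⟩
  by_contra hlt
  push Not at hlt
  apply hm
  have : ∀ i, ((B.down i : C.K) t).coeff m = 0 := fun i => by
    rcases lt_or_ge i I with hi | hi
    · exact h i hi m hlt
    · exact hI i hi t m (hlt.trans_le hN)
  simp [this]

/-- The component in `ℂ((z_s))((w_t))` of the Green kernel `G = -∑_i e^i ⊗ e_i`. The sum giving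
the coefficient of each power of `w_t` is finite, because `e_i → 0`. -/
def green (s t : C.S) : Laurent₂ :=
  HahnSeries.ofSuppBddBelow
    (fun m : ℤ => -∑ᶠ i, ((B.down i : C.K) t).coeff m • ((B.up i : C.R) : C.K) s)
    (B.green_bddBelow s t)

/-- `γ = (∂ ⊗ 1) G - G²`. -/
def gamma (s t : C.S) : Laurent₂ := C.delZ s (B.green s t) - B.green s t ^ 2

/-- `ψ(ħ, (∂^i ⊗ 1) γ)`, obtained by substituting `(∂^i ⊗ 1) γ` for `γ_i` in `ψ`. -/
def psiGamma (s t : C.S) : PowerSeries Laurent₂ :=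
  PowerSeries.map
    (MvPolynomial.eval₂Hom ((HahnSeries.C : Laurent ℂ →+* Laurent₂).comp HahnSeries.C)
      fun i : ℕ => (C.delZ s)^[i] (B.gamma s t)) psi

end DualBases

end MarkedCurve

end GreenKernel

end

/-! Near the diagonal write `x = z - w`, `α = 1/ω_s`, `A = ℂ((z, w))`. The operator `δ = ∂/∂ħ - ∂`
on `A[[ħ]]` is conjugate to `∂/∂ħ` by `e^{-ħ∂}`, so "`e^{-ħ∂} F` is divisible by `x`" means that
every `δ^k F` has constant term in `(x)`. These `F` form an ideal `J`. Since `A` contains `ℚ`, `ħF ∈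
J` forces `F ∈ J`, hence any `P ∈ J` with `P(0) = x` generates `J`
(`exists_eq_mul_of_mem_flowIdeal`). It remains to see that both sides of the claim lie in `J`; they
have constant term `x`, so their ratio `i` has constant term `1`.

For `z - q^{-∂}w`, the flow gives `q^{-∂}z - q^{-∂}w`, and `f(z) - f(w)` is always divisible by `x`
(`shiftSeries_mem_flowIdeal`).

For `P = x + xGψ`, substitution turns the equation of `ψ` into the Riccati equation `δψ = -1 - γψ²`,
while `γ = ∂G - G²` is a Riccati equation for `G`. Together they make `δP` a multiple of `P`, up to
the factor `xG`, which is invertible modulo `x`. So `P` stays divisible by `x` along the flow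
(`riccati_mem_flowIdeal`).

This needs `xG` and `γ` to lie in `A`, which follows from `G(z,w) + G(w,z) = -α δ(z,w)`
(`exists_diagonal_structure`). That identity, and the antisymmetry `G_{s,t}(z,w) = -G_{t,s}(w,z)`
for `s ≠ t`, hold because `R` and `Λ` are complementary and both isotropic
(`DualBases.green_add_transpose`). Off the diagonal the antisymmetry puts `G_{s,t}` in `ℂ((z,w))`,
and `1 + Gψ` is simply inverted.

Isotropy of `Λ` is assumed; isotropy of `R` is the residue theorem, proved in the last parts by
Stokes' theorem with a partition of unity. -/

noncomputable section

namespace GreenKernel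

/-- A derivation over `ℤ` from an additive map satisfying the Leibniz rule. -/
def derivationOfAddHom {A : Type*} [CommRing A] (D : A →+ A)
    (hD : ∀ a b, D (a * b) = a * D b + b * D a) : Derivation ℤ A A where
  toFun := D
  map_add' := map_add D
  map_smul' k a := by
    rw [RingHom.id_apply, map_zsmul]
  map_one_eq_zero' := by simpa using hD 1 1
  leibniz' := hD

/-! ### The derivation `∂/∂ħ - ∂` of `A[[ħ]]` and its invariant ideals -/

section Flow

variable {A : Type*} [CommRing A] (d : Derivation ℤ A A)

/-- The coefficientwise extension of a derivation of `A` to `A[[ħ]]`. -/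
def mapDer : Derivation ℤ (PowerSeries A) (PowerSeries A) where
  toFun F := PowerSeries.mk fun n => d (PowerSeries.coeff n F)
  map_add' F G := by ext; simp
  map_smul' k F := by
    ext n
    have h : ∀ G : PowerSeries A, PowerSeries.coeff n (k • G) = k • PowerSeries.coeff n G :=
      map_zsmul (PowerSeries.coeff n) k
    rw [RingHom.id_apply, h, PowerSeries.coeff_mk, PowerSeries.coeff_mk, ← map_zsmul]
    exact congrArg d (by simp)
  map_one_eq_zero' := by
    ext n
    change PowerSeries.coeff n (PowerSeries.mk fun n => d (PowerSeries.coeff n 1)) = 0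
    simp [PowerSeries.coeff_one, apply_ite d]
  leibniz' F G := by
    ext n
    change PowerSeries.coeff n (PowerSeries.mk fun n => d (PowerSeries.coeff n (F * G))) =
      PowerSeries.coeff n (F * (PowerSeries.mk fun n => d (PowerSeries.coeff n G)) +
        G * PowerSeries.mk fun n => d (PowerSeries.coeff n F))
    rw [mul_comm G]
    simp only [PowerSeries.coeff_mk, PowerSeries.coeff_mul, map_add, map_sum,
      Derivation.leibniz, smul_eq_mul, Finset.sum_add_distrib]
    simp only [mul_comm]

@[simp] theorem coeff_mapDer (F : PowerSeries A) (n : ℕ) :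
    PowerSeries.coeff n (mapDer d F) = d (PowerSeries.coeff n F) :=
  PowerSeries.coeff_mk n fun n => d (PowerSeries.coeff n F)

theorem mapDer_C (a : A) : mapDer d (PowerSeries.C a) = PowerSeries.C (d a) := by
  ext n
  simp [PowerSeries.coeff_C, apply_ite d]

theorem mapDer_X_mul (F : PowerSeries A) :
    mapDer d (PowerSeries.X * F) = PowerSeries.X * mapDer d F := by
  ext n
  rw [coeff_mapDer]
  cases n with
  | zero => simp only [PowerSeries.coeff_zero_X_mul, map_zero]
  | succ n => simp only [PowerSeries.coeff_succ_X_mul, coeff_mapDer]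

/-- The derivation `∂/∂ħ - ∂` of `A[[ħ]]`. -/
def flowDer : Derivation ℤ (PowerSeries A) (PowerSeries A) :=
  (PowerSeries.derivative A).restrictScalars ℤ - mapDer d

theorem flowDer_apply (F : PowerSeries A) :
    flowDer d F = PowerSeries.derivative A F - mapDer d F := rfl

theorem flowDer_C (a : A) : flowDer d (PowerSeries.C a) = -PowerSeries.C (d a) := by
  rw [flowDer_apply, mapDer_C, PowerSeries.derivative_C, zero_sub]

theorem flowDer_X_mul (F : PowerSeries A) :
    flowDer d (PowerSeries.X * F) = F + PowerSeries.X * flowDer d F := by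
  rw [flowDer_apply, flowDer_apply, mapDer_X_mul, Derivation.leibniz, PowerSeries.derivative_X]
  simp only [smul_eq_mul]
  ring

variable (x : A)

/-- The series `F` such that the first `n` derivatives of `e^{-ħ∂} F` at `ħ = 0` vanish
modulo `x`. -/
def flowIdeal : ℕ → Ideal (PowerSeries A)
  | 0 => ⊤
  | n + 1 =>
    { carrier := {F | F ∈ flowIdeal n ∧ x ∣ PowerSeries.constantCoeff F ∧
        flowDer d F ∈ flowIdeal n}
      zero_mem' := by simp
      add_mem' := by
        rintro F G ⟨h1, h2, h3⟩ ⟨h4, h5, h6⟩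
        refine ⟨add_mem h1 h4, ?_, ?_⟩
        · rw [map_add]
          exact dvd_add h2 h5
        · rw [map_add]
          exact add_mem h3 h6
      smul_mem' := by
        rintro F G ⟨h1, h2, h3⟩
        refine ⟨Ideal.mul_mem_left _ _ h1, ?_, ?_⟩
        · rw [smul_eq_mul, map_mul]
          exact h2.mul_left _
        · rw [smul_eq_mul, Derivation.leibniz]
          exact add_mem (Ideal.mul_mem_left _ _ h3) (Ideal.mul_mem_right _ _ h1) }

variable {d x}

theorem mem_flowIdeal_succ {n : ℕ} {F : PowerSeries A} :
    F ∈ flowIdeal d x (n + 1) ↔ F ∈ flowIdeal d x n ∧ x ∣ PowerSeries.constantCoeff F ∧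
      flowDer d F ∈ flowIdeal d x n := Iff.rfl

/-- Cancellation of `h` passes from constant terms modulo `x` to the whole ideal: in `δ(hF) = hδF +
Fδh` the last term is already under control, so `hδF` is too, and induction applies to `δF`. -/
theorem mem_flowIdeal_of_mul_mem {h : PowerSeries A}
    (hh : ∀ a, x ∣ PowerSeries.constantCoeff h * a → x ∣ a) {n : ℕ} :
    ∀ {F : PowerSeries A}, h * F ∈ flowIdeal d x n → F ∈ flowIdeal d x n := by
  induction n with
  | zero => exact fun _ => Submodule.mem_top
  | succ n ih =>
    intro F hF
    obtain ⟨h1, h2, h3⟩ := mem_flowIdeal_succ.1 hF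
    refine mem_flowIdeal_succ.2 ⟨ih h1, hh _ (by rwa [map_mul] at h2), ih ?_⟩
    rw [Derivation.leibniz, smul_eq_mul, smul_eq_mul] at h3
    exact (Submodule.add_mem_iff_left _ (Ideal.mul_mem_right _ _ (ih h1))).1 h3

/-- The form of `X`-cancellation that is stable under induction: applying `δ` to `(k+1)F + XδF`
gives `(k+2)δF + Xδ(δF)`, the same shape with `k + 1` and `δF`. The case `k = 0` is `δ(XF)`. -/
theorem mem_flowIdeal_of_add_X_mul_mem (hA : ∀ k : ℕ, ∀ a : A, x ∣ (k + 1 : ℕ) * a → x ∣ a)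
    {n : ℕ} : ∀ (k : ℕ) {F : PowerSeries A},
      ((k + 1 : ℕ) : PowerSeries A) * F + PowerSeries.X * flowDer d F ∈ flowIdeal d x n →
        F ∈ flowIdeal d x n := by
  induction n with
  | zero => exact fun _ _ _ => Submodule.mem_top
  | succ n ih =>
    intro k F hF
    obtain ⟨h1, h2, h3⟩ := mem_flowIdeal_succ.1 hF
    refine mem_flowIdeal_succ.2 ⟨ih k h1, hA k _ (by simpa using h2), ih (k + 1) ?_⟩
    rw [map_add, flowDer_X_mul, Derivation.leibniz, Derivation.map_natCast] at h3
    convert h3 using 1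
    simp only [smul_eq_mul, mul_zero]
    push_cast
    ring

theorem mem_flowIdeal_of_X_mul_mem (hA : ∀ k : ℕ, ∀ a : A, x ∣ (k + 1 : ℕ) * a → x ∣ a)
    {n : ℕ} {F : PowerSeries A} (hF : PowerSeries.X * F ∈ flowIdeal d x (n + 1)) :
    F ∈ flowIdeal d x n := by
  obtain ⟨-, -, h3⟩ := mem_flowIdeal_succ.1 hF
  rw [flowDer_X_mul] at h3
  exact mem_flowIdeal_of_add_X_mul_mem hA 0 (by simpa using h3)

/-- Division in the ideal of all series `F` with `e^{-ħ∂} F = 0` modulo `x`. -/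
theorem exists_eq_mul_of_mem_flowIdeal (hx : ∀ a, x * a = x → a = 1)
    (hA : ∀ k : ℕ, ∀ a : A, x ∣ (k + 1 : ℕ) * a → x ∣ a) {P F : PowerSeries A}
    (hP : ∀ n, P ∈ flowIdeal d x n) (hP0 : PowerSeries.constantCoeff P = x)
    (hF : ∀ n, F ∈ flowIdeal d x n) (hF0 : PowerSeries.constantCoeff F = x) :
    ∃ i : PowerSeries A, PowerSeries.constantCoeff i = 1 ∧ F = i * P := by
  -- One division step: remove the constant term of `F` by a multiple of `P`, then divide by `ħ`
  -- without leaving the ideal. Iterating it produces the coefficients of the quotient.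
  have step : ∀ F : {F : PowerSeries A // ∀ n, F ∈ flowIdeal d x n},
      ∃ (a : A) (F' : {F : PowerSeries A // ∀ n, F ∈ flowIdeal d x n}),
        F.1 = PowerSeries.C a * P + PowerSeries.X * F'.1 := by
    rintro ⟨F, hF⟩
    obtain ⟨a, ha⟩ := (mem_flowIdeal_succ.1 (hF 1)).2.1
    have h0 : PowerSeries.X ∣ F - PowerSeries.C a * P := by
      rw [PowerSeries.X_dvd_iff]
      simp [ha, hP0, mul_comm]
    obtain ⟨F', hF'⟩ := h0
    refine ⟨a, ⟨F', fun n => mem_flowIdeal_of_X_mul_mem hA ?_⟩, ?_⟩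
    · rw [← hF']
      exact sub_mem (hF _) (Ideal.mul_mem_left _ _ (hP _))
    · rw [← hF']
      ring
  choose a F' h using step
  let s : ℕ → {F : PowerSeries A // ∀ n, F ∈ flowIdeal d x n} := fun k => F'^[k] ⟨F, hF⟩
  have hs : ∀ k, (s k).1 = PowerSeries.C (a (s k)) * P + PowerSeries.X * (s (k + 1)).1 := by
    intro k
    simp only [s, Function.iterate_succ_apply']
    exact h _
  have hi : ∀ k, (PowerSeries.mk fun n => a (s (k + n))) =
      PowerSeries.C (a (s k)) + PowerSeries.X * PowerSeries.mk fun n => a (s (k + 1 + n)) := by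
    intro k
    ext n
    cases n with
    | zero => simp
    | succ n => simp [PowerSeries.coeff_succ_X_mul, add_assoc, add_comm 1 n]
  -- Quantified over the starting index `k`, because the coefficient of degree `n + 1` of one
  -- remainder involves the coefficient of degree `n` of the next.
  have key : ∀ n k, PowerSeries.coeff n (s k).1 =
      PowerSeries.coeff n ((PowerSeries.mk fun n => a (s (k + n))) * P) := by
    intro n
    induction n with
    | zero =>
      intro k
      rw [hs, hi]
      simp
    | succ n ih =>
      intro k
      rw [hs, hi, add_mul, mul_assoc, map_add, map_add, PowerSeries.coeff_succ_X_mul,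
        PowerSeries.coeff_succ_X_mul, ih]
  have hfin : F = (PowerSeries.mk fun n => a (s (0 + n))) * P := by
    ext n
    exact key n 0
  refine ⟨_, hx _ ?_, hfin⟩
  have := congrArg PowerSeries.constantCoeff hfin
  rw [map_mul, hF0, hP0] at this
  rw [mul_comm]
  exact this.symm

/-- The solution of a Riccati equation makes `x + h p` vanish along the flow. -/
theorem riccati_mem_flowIdeal {h g : A} {p : PowerSeries A}
    (hh : ∀ a, x ∣ h * a → x ∣ a) (hp0 : PowerSeries.constantCoeff p = 0)
    (hp : flowDer d p = -1 - PowerSeries.C g * p ^ 2)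
    (hg : x * d h - h * d x = x ^ 2 * g + h ^ 2) (n : ℕ) :
    PowerSeries.C x + PowerSeries.C h * p ∈ flowIdeal d x n := by
  induction n with
  | zero => exact Submodule.mem_top
  | succ n ih =>
    refine mem_flowIdeal_succ.2 ⟨ih, by simp [hp0], ?_⟩
    refine mem_flowIdeal_of_mul_mem (h := PowerSeries.C h) (by simpa using hh) ?_
    -- After multiplication by `h`, the two Riccati equations combine into a linear first-order
    -- equation for `x + hp`.
    have key : PowerSeries.C h * flowDer d (PowerSeries.C x + PowerSeries.C h * p) =
        (-PowerSeries.C (d h) + PowerSeries.C g * (PowerSeries.C x - PowerSeries.C h * p)) *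
          (PowerSeries.C x + PowerSeries.C h * p) := by
      have hg' := congrArg (PowerSeries.C (R := A)) hg
      simp only [map_sub, map_add, map_mul, map_pow] at hg'
      rw [map_add, Derivation.leibniz, flowDer_C, flowDer_C, hp, smul_eq_mul, smul_eq_mul]
      linear_combination hg'
    rw [key]
    exact Ideal.mul_mem_left _ _ ih

end Flow

/-! ### Substitution in `ψ` -/

section Substitution

variable {A : Type*} [CommRing A] (d : Derivation ℤ A A) (c : ℂ →+* A) (g : A)

/-- Substitution of `∂^i γ` for `γ_i`. -/
def jetEval : MvPolynomial ℕ ℂ →+* A := MvPolynomial.eval₂Hom c fun i => d^[i] g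

variable {c}

/-- The two sides are derivations along `jetEval`; they agree on constants, where both vanish, and
on each `γ_i`, where both give `∂^{i+1}γ`. -/
theorem jetEval_shiftDer (hc : ∀ z, d (c z) = 0) (p : MvPolynomial ℕ ℂ) :
    jetEval d c g (shiftDer p) = d (jetEval d c g p) := by
  induction p using MvPolynomial.induction_on with
  | C a =>
    rw [← MvPolynomial.algebraMap_eq, Derivation.map_algebraMap, map_zero,
      MvPolynomial.algebraMap_eq, jetEval, MvPolynomial.coe_eval₂Hom, MvPolynomial.eval₂_C, hc]
  | add p q hp hq => simp only [map_add, hp, hq]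
  | mul_X p i hp =>
    have hX : shiftDer (MvPolynomial.X i) = MvPolynomial.X (i + 1) := by
      simp [shiftDer, MvPolynomial.mkDerivation_X]
    have hX' : ∀ j, jetEval d c g (MvPolynomial.X j) = d^[j] g := fun j => by
      simp [jetEval]
    rw [Derivation.leibniz, hX, map_add, smul_eq_mul, smul_eq_mul, map_mul, map_mul, map_mul,
      hp, hX', hX', Derivation.leibniz, smul_eq_mul, smul_eq_mul, Function.iterate_succ_apply']

theorem constantCoeff_map_psi :
    PowerSeries.constantCoeff (PowerSeries.map (jetEval d c g) psi) = 0 := by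
  rw [← PowerSeries.coeff_zero_eq_constantCoeff_apply, PowerSeries.coeff_map,
    PowerSeries.coeff_zero_eq_constantCoeff_apply, constantCoeff_psi, map_zero]

theorem flowDer_map_psi (hc : ∀ z, d (c z) = 0) :
    flowDer d (PowerSeries.map (jetEval d c g) psi) =
      -1 - PowerSeries.C g * PowerSeries.map (jetEval d c g) psi ^ 2 := by
  have h1 : PowerSeries.derivative A (PowerSeries.map (jetEval d c g) psi) =
      PowerSeries.map (jetEval d c g) (PowerSeries.derivative (MvPolynomial ℕ ℂ) psi) := by
    ext n
    simp [PowerSeries.coeff_derivative]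
  have h2 : mapDer d (PowerSeries.map (jetEval d c g) psi) = PowerSeries.map (jetEval d c g)
      (PowerSeries.mk (fun n => shiftDer (PowerSeries.coeff n psi))) := by
    ext n
    simp [jetEval_shiftDer d g hc]
  have h3 : jetEval d c g (MvPolynomial.X 0) = g := by simp [jetEval]
  rw [flowDer_apply, h1, h2, derivative_psi]
  simp only [map_sub, map_mul, map_pow, map_one, PowerSeries.map_C, h3]
  ring

end Substitution

end GreenKernel

end

/-! ### Algebra of `ℂ((z))((w))` and `ℂ((z, w))`: derivations and divisibility by `z - w`. -/

noncomputable section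

namespace GreenKernel

/-! ### Laurent series in one variable -/

/-- Replaces the support-dependent antidiagonal of Hahn series by an interval depending only on
lower bounds of the exponents, so that sums for different factors can be matched, and an empty
interval shows that a coefficient vanishes. -/
theorem coeff_mul_eq_sum_Icc {R : Type*} [Semiring R] {f g : LaurentSeries R} {a b : ℤ}
    (hf : ∀ i < a, f.coeff i = 0) (hg : ∀ i < b, g.coeff i = 0) (n : ℤ) :
    (f * g).coeff n = ∑ i ∈ Finset.Icc a (n - b), f.coeff i * g.coeff (n - i) := by
  rw [HahnSeries.coeff_mul]
  refine Finset.sum_of_injOn Prod.fst ?_ ?_ ?_ ?_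
  · rintro ⟨i, j⟩ h ⟨i', j'⟩ h' (rfl : i = i')
    simp only [Finset.mem_coe, Finset.mem_antidiagonal] at h h'
    ext
    · rfl
    · simp only
      omega
  · rintro ⟨i, j⟩ h
    simp only [Finset.mem_coe, Finset.mem_antidiagonal, HahnSeries.mem_support] at h ⊢
    have h1 : ¬ i < a := fun hi => h.1 (hf i hi)
    have h2 : ¬ j < b := fun hi => h.2.1 (hg j hi)
    rw [Finset.mem_Icc]
    omega
  · intro i _ h'
    by_contra hne
    refine h' ⟨(i, n - i), ?_, rfl⟩
    simp only [Finset.mem_coe, Finset.mem_antidiagonal, HahnSeries.mem_support]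
    exact ⟨left_ne_zero_of_mul hne, right_ne_zero_of_mul hne, by omega⟩
  · rintro ⟨i, j⟩ h
    simp only [Finset.mem_antidiagonal] at h
    rw [← h.2.2]
    simp

theorem exists_coeff_eq_zero_of_lt {R : Type*} [Zero R] (f : LaurentSeries R) :
    ∃ N : ℤ, ∀ n < N, f.coeff n = 0 :=
  ⟨f.order, fun _ h => HahnSeries.coeff_eq_zero_of_lt_order h⟩

theorem coeff_derivative (f : Laurent ℂ) (n : ℤ) :
    (LaurentSeries.derivative ℂ f).coeff n = (n + 1) * f.coeff (n + 1) := by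
  rw [LaurentSeries.derivative_apply, LaurentSeries.hasseDeriv_coeff]
  simp

theorem derivative_mul (f g : Laurent ℂ) :
    LaurentSeries.derivative ℂ (f * g) =
      f * LaurentSeries.derivative ℂ g + g * LaurentSeries.derivative ℂ f := by
  obtain ⟨a, ha⟩ := exists_coeff_eq_zero_of_lt f
  obtain ⟨b, hb⟩ := exists_coeff_eq_zero_of_lt g
  have ha' : ∀ n < a - 1, (LaurentSeries.derivative ℂ f).coeff n = 0 := fun n hn => by
    rw [coeff_derivative, ha _ (by omega), mul_zero]
  have hb' : ∀ n < b - 1, (LaurentSeries.derivative ℂ g).coeff n = 0 := fun n hn => by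
    rw [coeff_derivative, hb _ (by omega), mul_zero]
  ext n
  rw [mul_comm g, HahnSeries.coeff_add, coeff_derivative, coeff_mul_eq_sum_Icc ha hb,
    coeff_mul_eq_sum_Icc ha hb', coeff_mul_eq_sum_Icc ha' hb]
  have e : ∑ i ∈ Finset.Icc (a - 1) (n - b),
      (LaurentSeries.derivative ℂ f).coeff i * g.coeff (n - i) =
      ∑ i ∈ Finset.Icc a (n + 1 - b), i * f.coeff i * g.coeff (n + 1 - i) := by
    refine Finset.sum_bij (fun i _ => i + 1) ?_ ?_ ?_ ?_
    · intro i hi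
      rw [Finset.mem_Icc] at hi ⊢
      omega
    · intro i _ j _ h
      omega
    · intro j hj
      rw [Finset.mem_Icc] at hj
      exact ⟨j - 1, by rw [Finset.mem_Icc]; omega, by omega⟩
    · intro i _
      rw [coeff_derivative]
      push_cast
      congr 2
      omega
  rw [e, Finset.mul_sum, show n - (b - 1) = n + 1 - b by ring, ← Finset.sum_add_distrib]
  refine Finset.sum_congr rfl fun i _ => ?_
  rw [coeff_derivative, show n - i + 1 = n + 1 - i by ring]
  push_cast
  ring

/-- The derivation `α d/dz` of `ℂ((z))`. -/
def scaledDer (α : Laurent ℂ) : Laurent ℂ →+ Laurent ℂ :=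
  (AddMonoidHom.mulLeft α).comp (LaurentSeries.derivative ℂ).toAddMonoidHom

theorem scaledDer_apply (α f : Laurent ℂ) :
    scaledDer α f = α * LaurentSeries.derivative ℂ f := rfl

theorem scaledDer_mul (α f g : Laurent ℂ) :
    scaledDer α (f * g) = f * scaledDer α g + g * scaledDer α f := by
  simp only [scaledDer_apply, derivative_mul]
  ring

theorem scaledDer_C (α : Laurent ℂ) (c : ℂ) : scaledDer α (HahnSeries.C c) = 0 := by
  have : LaurentSeries.derivative ℂ (HahnSeries.C c : Laurent ℂ) = 0 := by
    ext n
    rw [coeff_derivative, HahnSeries.C_apply, HahnSeries.coeff_single]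
    split_ifs with h
    · rw [HahnSeries.coeff_zero, show (n : ℂ) + 1 = 0 by exact_mod_cast h, zero_mul]
    · simp
  rw [scaledDer_apply, this, mul_zero]

theorem scaledDer_localVar (α : Laurent ℂ) : scaledDer α localVar = α := by
  have : LaurentSeries.derivative ℂ localVar = 1 := by
    ext n
    rw [coeff_derivative, localVar, HahnSeries.coeff_single, HahnSeries.coeff_one]
    by_cases h : n = 0
    · simp [h]
    · simp [h]
  rw [scaledDer_apply, this, mul_one]

theorem coeff_single_one_mul {R : Type*} [Semiring R] (f : LaurentSeries R) (n : ℤ) :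
    (HahnSeries.single (1 : ℤ) (1 : R) * f).coeff n = f.coeff (n - 1) := by
  have := HahnSeries.coeff_single_mul_add (r := (1 : R)) (x := f) (a := n - 1) (b := (1 : ℤ))
  rwa [sub_add_cancel, one_mul] at this

/-! ### Laurent series in two variables -/

theorem Laurent₂.ext {f g : Laurent₂} (h : ∀ m n, (f.coeff m).coeff n = (g.coeff m).coeff n) :
    f = g := by
  ext m n
  exact h m n

theorem coeff_inZ (f : Laurent ℂ) (m n : ℤ) :
    ((inZ f).coeff m).coeff n = if m = 0 then f.coeff n else 0 := by
  rw [inZ, HahnSeries.C_apply, HahnSeries.coeff_single]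
  split_ifs <;> simp

theorem coeff_inW (f : Laurent ℂ) (m n : ℤ) :
    ((inW f).coeff m).coeff n = if n = 0 then f.coeff m else 0 := by
  rw [inW, HahnSeries.map_coeff, HahnSeries.C_apply, HahnSeries.coeff_single]
  congr

theorem inW_mul (f g : Laurent ℂ) : inW (f * g) = inW f * inW g := by
  obtain ⟨a, ha⟩ := exists_coeff_eq_zero_of_lt f
  obtain ⟨b, hb⟩ := exists_coeff_eq_zero_of_lt g
  ext1
  funext m
  rw [coeff_mul_eq_sum_Icc (a := a) (b := b)]
  · simp only [inW, HahnSeries.map_coeff, ← map_mul, ← map_sum]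
    rw [coeff_mul_eq_sum_Icc ha hb]
  · intro i hi
    rw [inW, HahnSeries.map_coeff, ha i hi, map_zero]
  · intro i hi
    rw [inW, HahnSeries.map_coeff, hb i hi, map_zero]

theorem inW_one : inW 1 = 1 := by
  refine Laurent₂.ext fun m n => ?_
  rw [coeff_inW, HahnSeries.coeff_one, HahnSeries.coeff_one]
  by_cases hm : m = 0 <;> by_cases hn : n = 0 <;> simp [hm, hn, HahnSeries.coeff_one]

/-- The difference of the coordinates. -/
def coordDiff : Laurent₂ := inZ localVar - inW localVar

theorem coeff_coordDiff_mul (f : Laurent₂) (m n : ℤ) :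
    ((coordDiff * f).coeff m).coeff n =
      (f.coeff m).coeff (n - 1) - (f.coeff (m - 1)).coeff n := by
  have h : inW localVar = HahnSeries.single 1 1 := by
    refine Laurent₂.ext fun m n => ?_
    rw [coeff_inW, localVar, HahnSeries.coeff_single, HahnSeries.coeff_single]
    by_cases hm : m = 1 <;> by_cases hn : n = 0 <;> simp [hm, hn, HahnSeries.coeff_one]
  rw [coordDiff, sub_mul, HahnSeries.coeff_sub, HahnSeries.coeff_sub, h, coeff_single_one_mul,
    inZ, HahnSeries.C_mul_eq_smul, HahnSeries.coeff_smul, smul_eq_mul, localVar,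
    coeff_single_one_mul]

theorem coordDiff_ne_zero : coordDiff ≠ 0 := by
  intro h
  have := congrArg (fun f : Laurent₂ => (f.coeff 0).coeff 1) h
  simp [coordDiff, coeff_inZ, coeff_inW, localVar] at this

/-- The coefficientwise extension of an additive map to Laurent series. -/
def mapLaurent {R : Type*} [Ring R] (D : R →+ R) : LaurentSeries R →+ LaurentSeries R where
  toFun f := f.map D
  map_zero' := by ext; simp
  map_add' f g := by ext; simp

theorem coeff_mapLaurent {R : Type*} [Ring R] (D : R →+ R)
    (f : LaurentSeries R) (n : ℤ) : (mapLaurent D f).coeff n = D (f.coeff n) := rfl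

theorem mapLaurent_mul {R : Type*} [CommRing R] {D : R →+ R}
    (hD : ∀ a b, D (a * b) = a * D b + b * D a) (f g : LaurentSeries R) :
    mapLaurent D (f * g) = f * mapLaurent D g + g * mapLaurent D f := by
  obtain ⟨a, ha⟩ := exists_coeff_eq_zero_of_lt f
  obtain ⟨b, hb⟩ := exists_coeff_eq_zero_of_lt g
  have ha' : ∀ n < a, (mapLaurent D f).coeff n = 0 := fun n hn => by
    rw [coeff_mapLaurent, ha n hn, map_zero]
  have hb' : ∀ n < b, (mapLaurent D g).coeff n = 0 := fun n hn => by
    rw [coeff_mapLaurent, hb n hn, map_zero]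
  ext n
  rw [mul_comm g, coeff_mapLaurent, HahnSeries.coeff_add, coeff_mul_eq_sum_Icc ha hb,
    coeff_mul_eq_sum_Icc ha hb', coeff_mul_eq_sum_Icc ha' hb, map_sum,
    ← Finset.sum_add_distrib]
  refine Finset.sum_congr rfl fun i _ => ?_
  rw [hD, coeff_mapLaurent, coeff_mapLaurent,
    mul_comm (g.coeff _)]

/-! ### The ring `ℂ((z, w))` -/

/-- The ring `ℂ((z, w))`. -/
def boundedSubring : Subring Laurent₂ where
  carrier := boundedLaurent₂
  zero_mem' := ⟨0, fun _ _ _ => by simp⟩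
  one_mem' := ⟨0, fun m n h => by
    rw [HahnSeries.coeff_one]
    split_ifs
    · rw [HahnSeries.coeff_one, if_neg h.ne]
    · simp⟩
  add_mem' := by
    rintro f g ⟨a, ha⟩ ⟨b, hb⟩
    refine ⟨min a b, fun m n h => ?_⟩
    rw [HahnSeries.coeff_add, HahnSeries.coeff_add, ha m n (by omega), hb m n (by omega), add_zero]
  neg_mem' := by
    rintro f ⟨a, ha⟩
    refine ⟨a, fun m n h => ?_⟩
    rw [HahnSeries.coeff_neg, HahnSeries.coeff_neg, ha m n h, neg_zero]
  mul_mem' := by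
    rintro f g ⟨a, ha⟩ ⟨b, hb⟩
    refine ⟨a + b, fun m n h => ?_⟩
    obtain ⟨a', ha'⟩ := exists_coeff_eq_zero_of_lt f
    obtain ⟨b', hb'⟩ := exists_coeff_eq_zero_of_lt g
    rw [coeff_mul_eq_sum_Icc ha' hb', HahnSeries.coeff_sum]
    refine Finset.sum_eq_zero fun i _ => ?_
    rw [coeff_mul_eq_sum_Icc (ha i) (hb (m - i)), Finset.Icc_eq_empty (by omega),
      Finset.sum_empty]

theorem mem_boundedSubring {f : Laurent₂} :
    f ∈ boundedSubring ↔ ∃ N : ℤ, ∀ m n : ℤ, n < N → (f.coeff m).coeff n = 0 := Iff.rfl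

/-- A common lower bound for the exponents of both variables. -/
theorem exists_bound (f : boundedSubring) :
    ∃ N : ℤ, ∀ m n : ℤ, m < N ∨ n < N → (f.1.coeff m).coeff n = 0 := by
  obtain ⟨a, ha⟩ := mem_boundedSubring.1 f.2
  obtain ⟨b, hb⟩ := exists_coeff_eq_zero_of_lt f.1
  refine ⟨min a b, ?_⟩
  rintro m n (h | h)
  · rw [hb m (by omega), HahnSeries.coeff_zero]
  · exact ha m n (by omega)

theorem exists_of_coeff {N : ℤ} {c : ℤ → ℤ → ℂ} (hc : ∀ m n, m < N ∨ n < N → c m n = 0) :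
    ∃ f : boundedSubring, ∀ m n, (f.1.coeff m).coeff n = c m n := by
  have h1 : ∀ m, BddBelow (Function.support (c m)) := fun m => ⟨N, fun n hn => by
    by_contra h
    exact hn (hc m n (Or.inr (by omega)))⟩
  have h2 : BddBelow (Function.support fun m => HahnSeries.ofSuppBddBelow (c m) (h1 m)) := by
    refine ⟨N, fun m hm => ?_⟩
    by_contra h
    refine hm ?_
    ext n
    exact hc m n (Or.inl (by omega))
  exact ⟨⟨HahnSeries.ofSuppBddBelow _ h2, N, fun m n h => hc m n (Or.inr h)⟩, fun m n => rfl⟩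

theorem inZ_mem (f : Laurent ℂ) : inZ f ∈ boundedSubring := by
  obtain ⟨a, ha⟩ := exists_coeff_eq_zero_of_lt f
  refine ⟨a, fun m n h => ?_⟩
  rw [coeff_inZ, ha n h, ite_self]

theorem inW_mem (f : Laurent ℂ) : inW f ∈ boundedSubring := by
  refine ⟨0, fun m n h => ?_⟩
  rw [coeff_inW, if_neg h.ne]

/-- The difference of the coordinates, in `ℂ((z, w))`. -/
def bCoordDiff : boundedSubring := ⟨coordDiff, sub_mem (inZ_mem _) (inW_mem _)⟩

/-- The constants of `ℂ((z, w))`. -/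
def bConst : ℂ →+* boundedSubring :=
  ((HahnSeries.C : Laurent ℂ →+* Laurent₂).comp HahnSeries.C).codRestrict boundedSubring
    fun z => inZ_mem (HahnSeries.C z)

theorem scaledDer_coeff_eq_zero (α : Laurent ℂ) :
    ∃ b : ℤ, ∀ (f : Laurent ℂ) (a : ℤ), (∀ n < a, f.coeff n = 0) →
      ∀ n < a + b, (scaledDer α f).coeff n = 0 := by
  obtain ⟨b, hb⟩ := exists_coeff_eq_zero_of_lt α
  refine ⟨b - 1, fun f a ha n hn => ?_⟩
  have ha' : ∀ n < a - 1, (LaurentSeries.derivative ℂ f).coeff n = 0 := fun n hn => by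
    rw [coeff_derivative, ha _ (by omega), mul_zero]
  rw [scaledDer_apply, coeff_mul_eq_sum_Icc hb ha', Finset.Icc_eq_empty (by omega),
    Finset.sum_empty]

/-- The derivation `α(z) ∂/∂z` of `ℂ((z))((w))`. -/
def derZ (α : Laurent ℂ) : Laurent₂ →+ Laurent₂ := mapLaurent (scaledDer α)

theorem derZ_mul (α : Laurent ℂ) (f g : Laurent₂) :
    derZ α (f * g) = f * derZ α g + g * derZ α f :=
  mapLaurent_mul (scaledDer_mul α) f g

theorem derZ_mem (α : Laurent ℂ) {f : Laurent₂} (hf : f ∈ boundedSubring) :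
    derZ α f ∈ boundedSubring := by
  obtain ⟨b, hb⟩ := scaledDer_coeff_eq_zero α
  obtain ⟨a, ha⟩ := hf
  exact ⟨a + b, fun m n h => hb _ a (ha m) n h⟩

/-- The derivation `α(z) ∂/∂z` of `ℂ((z, w))`. -/
def bDer (α : Laurent ℂ) :=
  derivationOfAddHom (A := boundedSubring)
    { toFun := fun f => ⟨derZ α f.1, derZ_mem α f.2⟩
      map_zero' := Subtype.ext (map_zero (derZ α))
      map_add' := fun f g => Subtype.ext (map_add (derZ α) f.1 g.1) }
    fun f g => Subtype.ext (derZ_mul α f.1 g.1)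

theorem coe_bDer (α : Laurent ℂ) (f : boundedSubring) :
    (bDer α f : Laurent₂) = derZ α f.1 := rfl

theorem derZ_inZ (α f : Laurent ℂ) :
    derZ α (inZ f) = inZ (scaledDer α f) := by
  ext1
  funext m
  rw [derZ, coeff_mapLaurent, inZ, inZ, HahnSeries.C_apply, HahnSeries.C_apply,
    HahnSeries.coeff_single, HahnSeries.coeff_single]
  split_ifs <;> simp

theorem derZ_inW (α f : Laurent ℂ) : derZ α (inW f) = 0 := by
  ext1
  funext m
  rw [derZ, coeff_mapLaurent, inW, HahnSeries.map_coeff, scaledDer_C, HahnSeries.coeff_zero]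

theorem bDer_bConst (α : Laurent ℂ) (c : ℂ) : bDer α (bConst c) = 0 := by
  refine Subtype.ext ?_
  change derZ α (inZ (HahnSeries.C c)) = 0
  rw [derZ_inZ, scaledDer_C, inZ, map_zero]

/-- The exchange of the variables `z` and `w` changes an element of `ℂ((z, w))` by a multiple of
`z - w`. -/
theorem bCoordDiff_dvd_of_antisymm {f : boundedSubring}
    (hf : ∀ m n, (f.1.coeff m).coeff n = -(f.1.coeff n).coeff m) : bCoordDiff ∣ f := by
  obtain ⟨N, hN⟩ := exists_bound f
  set c : ℤ → ℤ → ℂ := fun m n => (f.1.coeff m).coeff n with hc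
  -- These are the coefficients of `f/(z - w)` with `1/(z - w) = ∑ w^k z^{-k-1}`. Only boundedness
  -- in `z` is in question: for `n < N` the sum runs over the whole antidiagonal of total degree `n
  -- + 1 + m`, and there antisymmetry makes it equal to its own negative.
  obtain ⟨g, hg⟩ := exists_of_coeff (N := N)
    (c := fun m n => ∑ j ∈ Finset.Icc N m, c j (n + 1 + m - j)) (by
      rintro m n h
      by_cases hm : m < N
      · rw [Finset.Icc_eq_empty (by omega), Finset.sum_empty]
      have hn : n < N := by omega
      have h1 : ∑ j ∈ Finset.Icc N m, c j (n + 1 + m - j) =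
          ∑ j ∈ Finset.Icc N (n + 1 + m - N), c j (n + 1 + m - j) := by
        refine (Finset.sum_subset (Finset.Icc_subset_Icc le_rfl (by omega)) ?_).symm
        intro j _ hj
        refine hN _ _ ?_
        rw [Finset.mem_Icc] at hj
        by_cases hjN : N ≤ j
        · exact Or.inr (by omega)
        · exact Or.inl (by omega)
      have h2 : ∑ j ∈ Finset.Icc N (n + 1 + m - N), c j (n + 1 + m - j) =
          ∑ j ∈ Finset.Icc N (n + 1 + m - N), c (n + 1 + m - j) j := by
        refine Finset.sum_nbij' (fun j => n + 1 + m - j) (fun j => n + 1 + m - j) ?_ ?_ ?_ ?_ ?_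
        · intro j hj
          rw [Finset.mem_Icc] at hj ⊢
          omega
        · intro j hj
          rw [Finset.mem_Icc] at hj ⊢
          omega
        · intro j _
          omega
        · intro j _
          omega
        · intro j _
          rw [sub_sub_cancel]
      have h3 : ∑ j ∈ Finset.Icc N (n + 1 + m - N), c j (n + 1 + m - j) =
          -∑ j ∈ Finset.Icc N (n + 1 + m - N), c (n + 1 + m - j) j := by
        rw [← Finset.sum_neg_distrib]
        exact Finset.sum_congr rfl fun j _ => hf _ _
      rw [h1]
      rw [← h2] at h3
      exact self_eq_neg.1 h3)
  refine ⟨g, Subtype.ext (Laurent₂.ext fun m n => ?_)⟩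
  change _ = ((coordDiff * g.1).coeff m).coeff n
  rw [coeff_coordDiff_mul, hg, hg]
  have e : ∀ j, c j (n - 1 + 1 + m - j) = c j (n + 1 + (m - 1) - j) := fun j => by
    congr 1
    ring
  simp only [e]
  by_cases hm : m < N
  · rw [hN m n (Or.inl hm), Finset.Icc_eq_empty (by omega), Finset.Icc_eq_empty (by omega)]
    simp
  · have : Finset.Icc N m = insert m (Finset.Icc N (m - 1)) := by
      ext j
      simp only [Finset.mem_Icc, Finset.mem_insert]
      omega
    rw [this, Finset.sum_insert (by simp), add_sub_cancel_right]
    simp only [hc]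
    congr 1
    ring

end GreenKernel

end

/-! ### The factorisation for a single kernel, near and away from the diagonal. -/

noncomputable section

namespace GreenKernel

/-! ### The local form of the theorem -/

/-- `f(z)` in `ℂ((z, w))`. -/
def bZ (f : Laurent ℂ) : boundedSubring := ⟨inZ f, inZ_mem f⟩

/-- `f(w)` in `ℂ((z, w))`. -/
def bW (f : Laurent ℂ) : boundedSubring := ⟨inW f, inW_mem f⟩

theorem bW_smul (c : ℂ) (f : Laurent ℂ) : bW (c • f) = bConst c * bW f := by
  refine Subtype.ext (Laurent₂.ext fun m n => ?_)
  change ((inW (c • f)).coeff m).coeff n =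
    ((HahnSeries.C (HahnSeries.C c : Laurent ℂ) * inW f : Laurent₂).coeff m).coeff n
  rw [HahnSeries.C_mul_eq_smul, HahnSeries.coeff_smul, smul_eq_mul, HahnSeries.C_mul_eq_smul,
    HahnSeries.coeff_smul, coeff_inW, coeff_inW]
  split_ifs <;> simp

theorem bDer_bZ (α f : Laurent ℂ) : bDer α (bZ f) = bZ (scaledDer α f) :=
  Subtype.ext (derZ_inZ α f)

theorem bDer_bW (α f : Laurent ℂ) : bDer α (bW f) = 0 :=
  Subtype.ext (derZ_inW α f)

theorem bW_mul_inv {f : Laurent ℂ} (hf : f ≠ 0) : bW f * bW f⁻¹ = 1 := by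
  refine Subtype.ext ?_
  change inW f * inW f⁻¹ = 1
  rw [← inW_mul, mul_inv_cancel₀ hf, inW_one]

theorem bCoordDiff_eq : bCoordDiff = bZ localVar - bW localVar := rfl

theorem bDer_bCoordDiff (α : Laurent ℂ) : bDer α bCoordDiff = bZ α := by
  rw [bCoordDiff_eq, map_sub, bDer_bZ, bDer_bW, scaledDer_localVar, sub_zero]

theorem bCoordDiff_ne_zero : bCoordDiff ≠ 0 := fun h =>
  coordDiff_ne_zero (congrArg Subtype.val h)

theorem bCoordDiff_dvd_bZ_sub_bW (f : Laurent ℂ) : bCoordDiff ∣ bZ f - bW f := by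
  refine bCoordDiff_dvd_of_antisymm fun m n => ?_
  change ((inZ f - inW f).coeff m).coeff n = -((inZ f - inW f).coeff n).coeff m
  rw [HahnSeries.coeff_sub, HahnSeries.coeff_sub, HahnSeries.coeff_sub, HahnSeries.coeff_sub,
    coeff_inZ, coeff_inZ, coeff_inW, coeff_inW]
  ring

/-- The series `f(z) - e^{-ħ∂} f(w)`. -/
def shiftSeries (α f : Laurent ℂ) : PowerSeries boundedSubring :=
  PowerSeries.C (bZ f) -
    PowerSeries.mk fun k => bW (((-1 : ℂ) ^ k / (k.factorial : ℂ)) • ((scaledDer α)^[k] f))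

theorem constantCoeff_shiftSeries (α f : Laurent ℂ) :
    PowerSeries.constantCoeff (shiftSeries α f) = bZ f - bW f := by
  simp [shiftSeries]

/-- `∂/∂ħ` sees only the `w`-part and `∂` only the `z`-part; each replaces `f` by `∂f`, up to the
same sign. The family of all `shiftSeries α f` is therefore stable under the flow. -/
theorem flowDer_shiftSeries (α f : Laurent ℂ) :
    flowDer (bDer α) (shiftSeries α f) = -shiftSeries α (scaledDer α f) := by
  have h1 : mapDer (bDer α) (PowerSeries.mk fun k =>
      bW (((-1 : ℂ) ^ k / (k.factorial : ℂ)) • ((scaledDer α)^[k] f))) = 0 := by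
    ext1 n
    rw [coeff_mapDer, PowerSeries.coeff_mk, bDer_bW, map_zero]
  have h2 : PowerSeries.derivative boundedSubring (PowerSeries.mk fun k =>
      bW (((-1 : ℂ) ^ k / (k.factorial : ℂ)) • ((scaledDer α)^[k] f))) =
      -PowerSeries.mk fun k => bW (((-1 : ℂ) ^ k / (k.factorial : ℂ)) •
        ((scaledDer α)^[k] (scaledDer α f))) := by
    ext1 n
    rw [PowerSeries.coeff_derivative, map_neg, PowerSeries.coeff_mk, PowerSeries.coeff_mk,
      Function.iterate_succ_apply, bW_smul, bW_smul,
      show ((n : boundedSubring) + 1) = bConst (n + 1) by rw [map_add, map_natCast, map_one],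
      mul_right_comm, ← map_mul, ← neg_mul, ← map_neg, Nat.factorial_succ]
    congr 2
    have : (n + 1 : ℂ) ≠ 0 := Nat.cast_add_one_ne_zero n
    have : (n.factorial : ℂ) ≠ 0 := Nat.cast_ne_zero.2 n.factorial_ne_zero
    push_cast
    field_simp
    ring
  rw [shiftSeries, map_sub, flowDer_C, bDer_bZ, flowDer_apply, h1, h2, shiftSeries]
  ring

/-- Only `f = z` is needed in the end, but the induction passes from `f` to `∂f`, so it must cover
all `f`. -/
theorem shiftSeries_mem_flowIdeal (α : Laurent ℂ) (n : ℕ) :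
    ∀ f, shiftSeries α f ∈ flowIdeal (bDer α) bCoordDiff n := by
  induction n with
  | zero => exact fun _ => Submodule.mem_top
  | succ n ih =>
    refine fun f => mem_flowIdeal_succ.2 ⟨ih f, ?_, ?_⟩
    · rw [constantCoeff_shiftSeries]
      exact bCoordDiff_dvd_bZ_sub_bW f
    · rw [flowDer_shiftSeries]
      exact neg_mem (ih _)

theorem coe_iterate_bDer (α : Laurent ℂ) (g : boundedSubring) (k : ℕ) :
    (((bDer α)^[k] g : boundedSubring) : Laurent₂) = (derZ α)^[k] g.1 := by
  induction k with
  | zero => rfl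
  | succ k ih => rw [Function.iterate_succ_apply', Function.iterate_succ_apply', coe_bDer, ih]

/-- The substitution of `(∂^i ⊗ 1) g` for `γ_i` in `ψ`. -/
def psiAt (α : Laurent ℂ) (g : Laurent₂) : PowerSeries Laurent₂ :=
  PowerSeries.map
    (MvPolynomial.eval₂Hom ((HahnSeries.C : Laurent ℂ →+* Laurent₂).comp HahnSeries.C)
      fun i : ℕ => (derZ α)^[i] g) psi

theorem map_subtype_map_psi (α : Laurent ℂ) (g : boundedSubring) :
    PowerSeries.map boundedSubring.subtype
      (PowerSeries.map (jetEval (bDer α) bConst g) psi) = psiAt α g.1 := by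
  have h : boundedSubring.subtype.comp (jetEval (bDer α) bConst g) =
      MvPolynomial.eval₂Hom ((HahnSeries.C : Laurent ℂ →+* Laurent₂).comp HahnSeries.C)
        fun i : ℕ => (derZ α)^[i] g.1 := by
    refine MvPolynomial.ringHom_ext (fun r => ?_) fun i => ?_
    · simp [jetEval, bConst]
      rfl
    · simp [jetEval, coe_iterate_bDer]
  ext1 n
  rw [psiAt, ← h]
  simp

theorem coeff_map_subtype_mem (i : PowerSeries boundedSubring) (k : ℕ) :
    PowerSeries.coeff k (PowerSeries.map boundedSubring.subtype i) ∈ boundedLaurent₂ := by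
  rw [PowerSeries.coeff_map]
  exact (PowerSeries.coeff k i).2

/-- The theorem away from the diagonal. -/
theorem exists_offDiagonal_factor (α : Laurent ℂ) {G : Laurent₂} (hG : G ∈ boundedSubring) :
    ∃ i : PowerSeries Laurent₂, (PowerSeries.constantCoeff i = 1 ∧
      ∀ k, PowerSeries.coeff k i ∈ boundedLaurent₂) ∧
      1 = i * (1 + PowerSeries.C G * psiAt α (derZ α G - G ^ 2)) := by
  set G' : boundedSubring := ⟨G, hG⟩
  set g : boundedSubring := bDer α G' - G' ^ 2
  set P : PowerSeries boundedSubring :=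
    1 + PowerSeries.C G' * PowerSeries.map (jetEval (bDer α) bConst g) psi with hP
  have hP0 : PowerSeries.constantCoeff P = ((1 : boundedSubringˣ) : boundedSubring) := by
    simp only [hP, map_add, map_mul, constantCoeff_map_psi, map_one, mul_zero, add_zero,
      Units.val_one]
  -- `ψ` has no constant term, so `P` has constant term `1` and is inverted within `ℂ((z, w))[[ħ]]`.
  have h := PowerSeries.mul_invOfUnit P 1 hP0
  refine ⟨PowerSeries.map boundedSubring.subtype (PowerSeries.invOfUnit P 1),
    ⟨?_, coeff_map_subtype_mem _⟩, ?_⟩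
  · rw [← PowerSeries.coeff_zero_eq_constantCoeff_apply, PowerSeries.coeff_map,
      PowerSeries.coeff_zero_eq_constantCoeff_apply, PowerSeries.constantCoeff_invOfUnit]
    simp
  · have h' := congrArg (PowerSeries.map boundedSubring.subtype) h
    rw [map_mul, map_one, mul_comm, hP, map_add, map_one, map_mul, map_subtype_map_psi] at h'
    refine h'.symm.trans ?_
    rw [PowerSeries.map_C]
    rfl

/-- The structure of a kernel `G` with `G(z, w) + G(w, z) = -α(z) δ(z, w)` near the diagonal. -/
theorem exists_diagonal_structure {α : Laurent ℂ} {G : Laurent₂}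
    (hG : ∀ m n, (G.coeff m).coeff n + (G.coeff n).coeff m = -α.coeff (m + n + 1)) :
    ∃ M N : boundedSubring, coordDiff * G = (bCoordDiff * M - bW α : boundedSubring) ∧
      bZ α - bW α + 2 * bCoordDiff * M = bCoordDiff ^ 2 * N := by
  obtain ⟨N₁, hN₁⟩ := exists_coeff_eq_zero_of_lt G
  obtain ⟨a, ha⟩ := exists_coeff_eq_zero_of_lt α
  -- `M = G + α(w)/(z - w)`, expanded in powers `w^k z^{-k-1}`, which accounts for the condition `n
  -- < 0`. For very negative `n` its coefficient is minus the transposed coefficient of `G`, which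
  -- is zero.
  obtain ⟨M, hM⟩ := exists_of_coeff (N := min (min N₁ a) 0)
    (c := fun m n => (G.coeff m).coeff n + if n < 0 then α.coeff (m + n + 1) else 0) (by
      rintro m n (h | h)
      · rw [hN₁ m (by omega), HahnSeries.coeff_zero, zero_add]
        split_ifs
        · exact ha _ (by omega)
        · rfl
      · rw [if_pos (by omega)]
        have := hG m n
        rw [hN₁ n (by omega), HahnSeries.coeff_zero] at this
        linear_combination this)
  obtain ⟨b, hb⟩ := exists_bound M
  -- `M'` is the transpose `M(w, z)`. Writing `2M = (M - M') + (M + M')`, the difference is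
  -- antisymmetric, hence divisible by `z - w`, and the symmetric part is computed from `hG`.
  obtain ⟨M', hM'⟩ := exists_of_coeff (N := b) (c := fun m n => (M.1.coeff n).coeff m)
    fun m n h => hb n m h.symm
  obtain ⟨N, hN⟩ := bCoordDiff_dvd_of_antisymm (f := M - M') (by
    intro m n
    change ((M.1 - M'.1).coeff m).coeff n = -((M.1 - M'.1).coeff n).coeff m
    simp only [HahnSeries.coeff_sub, hM']
    ring)
  have h1 : coordDiff * G = coordDiff * M.1 - inW α := by
    refine Laurent₂.ext fun m n => ?_
    rw [HahnSeries.coeff_sub, HahnSeries.coeff_sub, coeff_coordDiff_mul, coeff_coordDiff_mul,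
      hM, hM, coeff_inW]
    rcases lt_trichotomy n 0 with h | h | h
    · rw [if_pos (by omega), if_pos h, if_neg h.ne, show m - 1 + n + 1 = m + (n - 1) + 1 by ring]
      ring
    · subst h
      simp
      ring
    · rw [if_neg (by omega), if_neg (by omega), if_neg h.ne']
      ring
  have h2 : bCoordDiff * (M + M') = bW α - bZ α := by
    refine Subtype.ext (Laurent₂.ext fun m n => ?_)
    change ((coordDiff * (M.1 + M'.1)).coeff m).coeff n = ((inW α - inZ α).coeff m).coeff n
    have e : ∀ m n, ((coordDiff * G).coeff m).coeff n =
        (M.1.coeff m).coeff (n - 1) - (M.1.coeff (m - 1)).coeff n - ((inW α).coeff m).coeff n := by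
      intro m n
      rw [h1, HahnSeries.coeff_sub, HahnSeries.coeff_sub, coeff_coordDiff_mul]
    have e1 := e m n
    have e2 := e n m
    have g1 := hG m (n - 1)
    have g2 := hG (m - 1) n
    rw [show m + (n - 1) + 1 = m + n by ring] at g1
    rw [show m - 1 + n + 1 = m + n by ring] at g2
    rw [coeff_coordDiff_mul, coeff_inW] at e1 e2
    rw [coeff_coordDiff_mul, HahnSeries.coeff_sub, HahnSeries.coeff_sub]
    simp only [HahnSeries.coeff_add, hM', coeff_inW, coeff_inZ]
    linear_combination e2 - e1 + g1 - g2
  refine ⟨M, N, h1, ?_⟩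
  linear_combination bCoordDiff * hN + h2

/-- The theorem near the diagonal. -/
theorem exists_diagonal_factor {α : Laurent ℂ} (hα : α ≠ 0) {G : Laurent₂}
    (hG : ∀ m n, (G.coeff m).coeff n + (G.coeff n).coeff m = -α.coeff (m + n + 1)) :
    ∃ i : PowerSeries Laurent₂, (PowerSeries.constantCoeff i = 1 ∧
      ∀ k, PowerSeries.coeff k i ∈ boundedLaurent₂) ∧
      PowerSeries.C (inZ localVar) - PowerSeries.mk (fun k => inW
          (((-1 : ℂ) ^ k / (k.factorial : ℂ)) • ((scaledDer α)^[k] localVar))) =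
        i * (PowerSeries.C coordDiff +
          PowerSeries.C (coordDiff * G) * psiAt α (derZ α G - G ^ 2)) := by
  obtain ⟨M, N, hH, hN⟩ := exists_diagonal_structure hG
  set x := bCoordDiff with hx
  set d := bDer α with hd
  set H : boundedSubring := x * M - bW α with hHdef
  -- The value of `∂G - G²` for `G = M - α(w)/x`: the polar terms add up to `α(w)(α(z) - α(w) +
  -- 2xM)/x²`, which is `α(w)N` by `hN`.
  set g : boundedSubring := d M - M ^ 2 + bW α * N with hg
  have hdx : d x = bZ α := bDer_bCoordDiff α
  have hdH : d H = x * d M + M * bZ α := by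
    rw [hHdef, map_sub, Derivation.leibniz, hd, bDer_bW, ← hd, hdx, smul_eq_mul, smul_eq_mul,
      sub_zero]
  have hric : x * d H - H * d x = x ^ 2 * g + H ^ 2 := by
    rw [hdH, hdx, hg, hHdef]
    linear_combination bW α * hN
  have hgG : g.1 = derZ α G - G ^ 2 := by
    have h1 : coordDiff * derZ α (coordDiff * G) - coordDiff * G * derZ α coordDiff =
        coordDiff ^ 2 * g.1 + (coordDiff * G) ^ 2 := by
      rw [hH]
      exact congrArg Subtype.val hric
    rw [derZ_mul] at h1
    refine mul_left_cancel₀ (pow_ne_zero 2 coordDiff_ne_zero) ?_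
    linear_combination -h1
  -- Modulo `x`, `H` is the unit `-α(w)`.
  have hcancel : ∀ a, x ∣ H * a → x ∣ a := by
    rintro a ⟨b, hb⟩
    refine ⟨bW α⁻¹ * (M * a - b), ?_⟩
    rw [hHdef] at hb
    linear_combination -bW α⁻¹ * hb - a * bW_mul_inv hα
  have hA : ∀ k : ℕ, ∀ a : boundedSubring, x ∣ (k + 1 : ℕ) * a → x ∣ a := by
    rintro k a ⟨b, hb⟩
    have hk : bConst ((k + 1 : ℂ)⁻¹) * ((k + 1 : ℕ) : boundedSubring) = 1 := by
      rw [← map_natCast bConst, ← map_mul, Nat.cast_add_one,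
        inv_mul_cancel₀ (Nat.cast_add_one_ne_zero k), map_one]
    refine ⟨bConst ((k + 1 : ℂ)⁻¹) * b, ?_⟩
    linear_combination bConst ((k + 1 : ℂ)⁻¹) * hb - a * hk
  have hx1 : ∀ a, x * a = x → a = 1 := fun a h =>
    mul_left_cancel₀ bCoordDiff_ne_zero (h.trans (mul_one x).symm)
  set p := PowerSeries.map (jetEval d bConst g) psi with hp
  have hp0 : PowerSeries.constantCoeff p = 0 := constantCoeff_map_psi d g
  obtain ⟨i, hi0, hi⟩ := exists_eq_mul_of_mem_flowIdeal hx1 hA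
    (riccati_mem_flowIdeal hcancel hp0 (flowDer_map_psi d g (bDer_bConst α)) hric)
    (by rw [map_add, map_mul, hp0, mul_zero, add_zero, PowerSeries.constantCoeff_C])
    (fun n => shiftSeries_mem_flowIdeal α n localVar) (constantCoeff_shiftSeries α localVar)
  refine ⟨PowerSeries.map boundedSubring.subtype i, ⟨?_, coeff_map_subtype_mem _⟩, ?_⟩
  · rw [← PowerSeries.coeff_zero_eq_constantCoeff_apply, PowerSeries.coeff_map,
      PowerSeries.coeff_zero_eq_constantCoeff_apply, hi0, map_one]
  · have h := congrArg (PowerSeries.map boundedSubring.subtype) hi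
    rw [map_mul, map_add, map_mul, hp, map_subtype_map_psi, hgG, PowerSeries.map_C,
      PowerSeries.map_C] at h
    rw [hH]
    refine Eq.trans ?_ h
    rw [shiftSeries, map_sub, PowerSeries.map_C]
    congr 1

end GreenKernel

end

/-! ### From the curve to the kernels: the local form of `ω` and the symmetry of `G`. -/

noncomputable section

namespace GreenKernel

namespace MarkedCurve

/-! ### The differential near the marked points -/

section LocalForm

variable {X : Type*} [TopologicalSpace X] [ChartedSpace ℂ X] [IsManifold 𝓘(ℂ) ω X]
  (C : MarkedCurve X)

theorem zero_mem_target (s : C.S) : (0 : ℂ) ∈ (C.coord s).target := by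
  rw [← C.coord_self s]
  exact (C.coord s).map_source (C.mem_source s)

theorem coord_symm_zero (s : C.S) : (C.coord s).symm 0 = s := by
  rw [← C.coord_self s, (C.coord s).left_inv (C.mem_source s)]

theorem eventually_mem_target (s : C.S) : ∀ᶠ x in nhds (0 : ℂ), x ∈ (C.coord s).target :=
  (C.coord s).open_target.mem_nhds (C.zero_mem_target s)

theorem eventually_symm_notMem (s : C.S) :
    ∀ᶠ x in nhds (0 : ℂ), x ≠ 0 → (C.coord s).symm x ∉ C.S := by
  have hfin : (((C.S : Set X).image (C.coord s)) \ {0}).Finite :=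
    (C.S.finite_toSet.image _).sdiff
  have h0 : (((C.S : Set X).image (C.coord s)) \ {0})ᶜ ∈ nhds (0 : ℂ) :=
    hfin.isClosed.isOpen_compl.mem_nhds (by simp)
  filter_upwards [h0, C.eventually_mem_target s] with x hx hxt hx0 hxS
  exact hx ⟨⟨_, hxS, (C.coord s).right_inv hxt⟩, hx0⟩

theorem hasLaurentExpansion_formSeries (s : C.S) :
    HasLaurentExpansion (localCoeff C.form (C.coord s)) (C.formSeries s) :=
  (C.form_meromorphic s).choose_spec

/-- A zero expansion would make `ω` vanish at unmarked points near `s`, contrary to `form_regular`.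
This is what makes `α = 1/ω_s` a genuine inverse. -/
theorem formSeries_ne_zero (s : C.S) : C.formSeries s ≠ 0 := by
  intro h0
  have h1 := C.hasLaurentExpansion_formSeries s
  rw [h0] at h1
  have h2 : ∀ᶠ x in nhdsWithin (0 : ℂ) {0}ᶜ, False := by
    filter_upwards [h1, self_mem_nhdsWithin, nhdsWithin_le_nhds (C.eventually_mem_target s),
      nhdsWithin_le_nhds (C.eventually_symm_notMem s)] with x hx hx0 hxt hxS
    have h3 := (C.form_regular _ (hxS hx0) _ (C.coord_mem s) ((C.coord s).map_target hxt)).2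
    rw [(C.coord s).right_inv hxt] at h3
    refine h3 (hx.unique ?_)
    simp [hasSum_zero]
  exact (Filter.eventually_false_iff_eq_bot.1 h2 ▸ (inferInstance :
    (nhdsWithin (0 : ℂ) {0}ᶜ).NeBot)).ne rfl

end LocalForm

/-! ### The Green kernel and its transpose -/

section Pairing

variable {X : Type*} [TopologicalSpace X] [ChartedSpace ℂ X] [IsManifold 𝓘(ℂ) ω X]
  (C : MarkedCurve X)

/-- The pairing as a bilinear form. -/
def pairingForm : LinearMap.BilinForm ℂ C.K :=
  LinearMap.mk₂ ℂ C.pairing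
    (fun f f' g => by simp [pairing, add_mul, Finset.sum_add_distrib])
    (fun c f g => by
      rw [pairing, pairing, smul_eq_mul, Finset.mul_sum]
      refine Finset.sum_congr rfl fun s _ => ?_
      rw [Pi.smul_apply, ← HahnSeries.C_mul_eq_smul, mul_assoc, mul_assoc,
        HahnSeries.C_mul_eq_smul, HahnSeries.coeff_smul, smul_eq_mul, mul_assoc])
    (fun f g g' => by simp [pairing, mul_add, add_mul, Finset.sum_add_distrib])
    (fun c f g => by
      rw [pairing, pairing, smul_eq_mul, Finset.mul_sum]
      refine Finset.sum_congr rfl fun s _ => ?_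
      rw [Pi.smul_apply, ← HahnSeries.C_mul_eq_smul, mul_left_comm, mul_assoc,
        HahnSeries.C_mul_eq_smul, HahnSeries.coeff_smul, smul_eq_mul])

theorem pairingForm_apply (f g : C.K) : C.pairingForm f g = C.pairing f g := rfl

theorem pairing_comm (f g : C.K) : C.pairing f g = C.pairing g f := by
  simp only [pairing, mul_comm (f _)]

open Classical in
/-- The element of `𝒦` whose pairing with `f` is the coefficient of `z_s ^ n` in `f_s`. -/
def coeffDual (s : C.S) (n : ℤ) : C.K :=
  Pi.single s (HahnSeries.single (-1 - n) 1 * (C.formSeries s)⁻¹)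

theorem pairing_coeffDual (s : C.S) (n : ℤ) (f : C.K) :
    C.pairing (C.coeffDual s n) f = (f s).coeff n := by
  classical
  rw [pairing, Finset.sum_eq_single s]
  · rw [coeffDual, Pi.single_eq_same, mul_assoc, mul_comm (f s), mul_assoc,
      inv_mul_cancel_left₀ (C.formSeries_ne_zero s), HahnSeries.coeff_single_mul, one_mul]
    congr 1
    ring
  · intro t _ ht
    rw [coeffDual, Pi.single_eq_of_ne ht]
    simp
  · intro h
    exact absurd (Finset.mem_univ s) h

variable {C}

theorem DualBases.coeff_green {Λ : Submodule ℂ C.K} (B : C.DualBases Λ) (s t : C.S) (m n : ℤ)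
    {J : Finset ℕ} (hJ : ∀ i ∉ J, ((B.down i : C.K) t).coeff m = 0) :
    ((B.green s t).coeff m).coeff n =
      -∑ i ∈ J, ((B.down i : C.K) t).coeff m * (((B.up i : C.R) : C.K) s).coeff n := by
  change (-∑ᶠ i, ((B.down i : C.K) t).coeff m • ((B.up i : C.R) : C.K) s).coeff n = _
  rw [finsum_eq_sum_of_support_subset (s := J)]
  · simp [HahnSeries.coeff_sum]
  · intro i hi
    by_contra hiJ
    exact hi (by simp [hJ i hiJ])

theorem DualBases.repr_eq {Λ : Submodule ℂ C.K} (B : C.DualBases Λ) (r : C.R) (i : ℕ) :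
    B.up.repr r i = C.pairing r (B.down i) := by
  have h := congrArg (fun y : C.R => C.pairingForm y (B.down i)) (B.up.linearCombination_repr r)
  simp only [Finsupp.linearCombination_apply, Finsupp.sum, Submodule.coe_sum, map_sum,
    Submodule.coe_smul, map_smul, LinearMap.sum_apply, LinearMap.smul_apply, pairingForm_apply,
    B.dual, smul_eq_mul] at h
  rw [← h]
  simp

/-- The pairing of an element of `R` with an element of `𝒦`, in the basis of `R`. -/
theorem DualBases.pairing_eq_sum {Λ : Submodule ℂ C.K} (B : C.DualBases Λ) (r : C.R) (y : C.K) :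
    C.pairing r y = ∑ i ∈ (B.up.repr r).support,
      C.pairing r (B.down i) * C.pairing (B.up i : C.R) y := by
  have h := congrArg (fun r : C.R => C.pairingForm r y) (B.up.linearCombination_repr r)
  simp only [Finsupp.linearCombination_apply, Finsupp.sum, Submodule.coe_sum, map_sum,
    Submodule.coe_smul, map_smul, LinearMap.sum_apply, LinearMap.smul_apply, pairingForm_apply,
    smul_eq_mul] at h
  rw [← h]
  exact Finset.sum_congr rfl fun i _ => by rw [B.repr_eq]

/-- The kernel `G` and its transpose add up to the kernel of minus the identity. -/
theorem DualBases.green_add_transpose {Λ : Submodule ℂ C.K} (B : C.DualBases Λ)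
    (hΛ : C.IsLagrangianComplement Λ) (hR : ∀ f ∈ C.R, ∀ g ∈ C.R, C.pairing f g = 0)
    (s t : C.S) (m n : ℤ) :
    ((B.green s t).coeff m).coeff n + ((B.green t s).coeff n).coeff m =
      -(C.coeffDual t m s).coeff n := by
  have hdec : ∀ x : C.K, ∃ (r : C.R) (l : Λ), (r : C.K) + l = x := fun x => by
    have hx : x ∈ C.R ⊔ Λ := by rw [hΛ.isCompl.sup_eq_top]; trivial
    obtain ⟨r, hr, l, hl, h⟩ := Submodule.mem_sup.1 hx
    exact ⟨⟨r, hr⟩, ⟨l, hl⟩, h⟩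
  have hiso : ∀ l l' : Λ, C.pairing l l' = 0 := fun l l' => (hΛ.lagrangian l).1 l.2 l' l'.2
  -- Coefficients are pairings with `coeffDual`. Against `e_i ∈ Λ` only the `R`-part `r` survives,
  -- against `e^i ∈ R` only the `Λ`-part `l'`. So the sum over `i` is `⟨r, l'⟩` expanded in the dual
  -- bases, with finitely many terms because `r` has a finite expansion in the basis of `R`.
  have key : ∀ (s t : C.S) (m n : ℤ) (r r' : C.R) (l l' : Λ),
      (r : C.K) + l = C.coeffDual s n → (r' : C.K) + l' = C.coeffDual t m →
      ((B.green t s).coeff n).coeff m = -C.pairing r l' := by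
    intro s t m n r r' l l' h h'
    have h1 : ∀ i, C.pairing r (B.down i) = ((B.down i : C.K) s).coeff n := fun i => by
      rw [← pairing_coeffDual, ← h]
      simp only [← pairingForm_apply, map_add, LinearMap.add_apply]
      rw [pairingForm_apply C l, hiso, add_zero]
    have h2 : ∀ i, C.pairing (B.up i : C.R) l' = (((B.up i : C.R) : C.K) t).coeff m := fun i => by
      rw [← pairing_coeffDual, ← h', pairing_comm]
      simp only [← pairingForm_apply, map_add, LinearMap.add_apply]
      rw [pairingForm_apply C r', hR _ r'.2 _ (B.up i).2, zero_add]
    rw [B.coeff_green t s n m (J := (B.up.repr r).support), B.pairing_eq_sum]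
    · simp only [h1, h2]
    · intro i hi
      rw [← h1, ← B.repr_eq]
      exact Finsupp.notMem_support_iff.1 hi
  obtain ⟨r, l, h⟩ := hdec (C.coeffDual s n)
  obtain ⟨r', l', h'⟩ := hdec (C.coeffDual t m)
  -- The two cross terms make up all of `⟨r + l, r' + l'⟩`, since `⟨r, r'⟩` and `⟨l, l'⟩` vanish.
  rw [key s t m n r r' l l' h h', key t s n m r' r l' l h' h, ← pairing_coeffDual C s n, ← h, ← h']
  simp only [← pairingForm_apply, map_add, LinearMap.add_apply]
  rw [pairingForm_apply C l l', hiso, pairingForm_apply C r r', hR _ r.2 _ r'.2,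
    pairingForm_apply C l r', pairing_comm C l r', pairingForm_apply]
  ring

/-- The theorem, when the pairing vanishes on `R`. -/
theorem DualBases.exists_factor {Λ : Submodule ℂ C.K} (B : C.DualBases Λ)
    (hΛ : C.IsLagrangianComplement Λ) (hR : ∀ f ∈ C.R, ∀ g ∈ C.R, C.pairing f g = 0) :
    ∃ i : C.S → C.S → PowerSeries Laurent₂,
      (∀ s t, PowerSeries.constantCoeff (i s t) = 1 ∧
        ∀ k, PowerSeries.coeff k (i s t) ∈ boundedLaurent₂) ∧
      (∀ s, PowerSeries.C (inZ localVar) - C.shiftedW s =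
          i s s * (PowerSeries.C (inZ localVar - inW localVar) +
            PowerSeries.C ((inZ localVar - inW localVar) * B.green s s) * B.psiGamma s s)) ∧
      (∀ s t, s ≠ t → 1 = i s t * (1 + PowerSeries.C (B.green s t) * B.psiGamma s t)) := by
  classical
  have hdiag : ∀ s : C.S, ∃ i : PowerSeries Laurent₂, (PowerSeries.constantCoeff i = 1 ∧
      ∀ k, PowerSeries.coeff k i ∈ boundedLaurent₂) ∧
      PowerSeries.C (inZ localVar) - C.shiftedW s =
          i * (PowerSeries.C (inZ localVar - inW localVar) +
            PowerSeries.C ((inZ localVar - inW localVar) * B.green s s) * B.psiGamma s s) := by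
    intro s
    -- On the diagonal `coeffDual` is `z^{-1-m}/ω_s`, whose `n`-th coefficient is that of `α` in
    -- degree `m + n + 1`. The operator `del s` is `scaledDer α` by definition.
    refine exists_diagonal_factor (inv_ne_zero (C.formSeries_ne_zero s)) fun m n => ?_
    rw [B.green_add_transpose hΛ hR, coeffDual, Pi.single_eq_same, HahnSeries.coeff_single_mul,
      one_mul]
    congr 2
    ring
  have hoff : ∀ s t : C.S, s ≠ t → ∃ i : PowerSeries Laurent₂,
      (PowerSeries.constantCoeff i = 1 ∧ ∀ k, PowerSeries.coeff k i ∈ boundedLaurent₂) ∧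
      1 = i * (1 + PowerSeries.C (B.green s t) * B.psiGamma s t) := by
    intro s t hst
    -- For `s ≠ t`, `coeffDual` at `t` has no component at `s`. So `G_{s,t}` is minus the transpose
    -- of `G_{t,s}`, and the lower bound of the latter in its outer variable bounds `G_{s,t}` in
    -- `z`.
    refine exists_offDiagonal_factor (C.formSeries s)⁻¹ ?_
    obtain ⟨N, hN⟩ := exists_coeff_eq_zero_of_lt (B.green t s)
    refine ⟨N, fun m n h => ?_⟩
    have := B.green_add_transpose hΛ hR s t m n
    rw [hN n h, coeffDual, Pi.single_eq_of_ne hst] at this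
    simpa using this
  choose f hf hf' using hdiag
  choose g hg hg' using hoff
  refine ⟨fun s t => if h : s = t then f s else g s t h, ?_, ?_, ?_⟩
  · intro s t
    by_cases h : s = t
    · simpa [h] using hf t
    · simpa [h] using hg s t h
  · intro s
    simpa using hf' s
  · intro s t h
    simpa [h] using hg' s t h

end Pairing

end MarkedCurve

end GreenKernel

end

/-! ### Analysis in one complex variable: residues, `∂/∂x̄` and radial cutoffs. -/

noncomputable section

namespace GreenKernel

/-! ### Products and residues of convergent Laurent series -/

/-- A convergent series in `ℂ` converges absolutely, so the double series may be regrouped by total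
degree, each degree receiving finitely many nonzero terms. -/
theorem HasLaurentExpansion.mul {f g : ℂ → ℂ} {L M : Laurent ℂ}
    (hf : HasLaurentExpansion f L) (hg : HasLaurentExpansion g M) :
    HasLaurentExpansion (fun x => f x * g x) (L * M) := by
  filter_upwards [hf, hg, self_mem_nhdsWithin] with x h1 h2 (hx : x ≠ 0)
  obtain ⟨a, ha⟩ := exists_coeff_eq_zero_of_lt L
  obtain ⟨b, hb⟩ := exists_coeff_eq_zero_of_lt M
  have hs : Summable fun p : ℤ × ℤ => L.coeff p.1 * x ^ p.1 * (M.coeff p.2 * x ^ p.2) :=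
    summable_mul_of_summable_norm (f := fun n => L.coeff n * x ^ n)
      (g := fun n => M.coeff n * x ^ n) h1.summable.norm h2.summable.norm
  have h : HasSum (fun p : ℤ × ℤ => L.coeff p.1 * x ^ p.1 * (M.coeff p.2 * x ^ p.2))
      (f x * g x) := by
    rw [h1.mul_eq h2 hs.hasSum]
    exact hs.hasSum
  obtain ⟨e, he⟩ : ∃ e : ℤ × ℤ ≃ ℤ × ℤ, ∀ p, e p = (p.2, p.1 - p.2) :=
    ⟨{ toFun := fun p => (p.2, p.1 - p.2)
       invFun := fun p => (p.1 + p.2, p.1)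
       left_inv := fun p => by simp
       right_inv := fun p => by simp }, fun _ => rfl⟩
  have hterm : ∀ p : ℤ × ℤ,
      (fun q : ℤ × ℤ => L.coeff q.1 * x ^ q.1 * (M.coeff q.2 * x ^ q.2)) (e p) =
        L.coeff p.2 * M.coeff (p.1 - p.2) * x ^ p.1 := by
    rintro ⟨n, i⟩
    simp only [he]
    rw [show x ^ n = x ^ i * x ^ (n - i) by rw [← zpow_add₀ hx]; congr 1; ring]
    ring
  have h' : HasSum (fun p : ℤ × ℤ => L.coeff p.2 * M.coeff (p.1 - p.2) * x ^ p.1) (f x * g x) := by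
    have h' := e.hasSum_iff.2 h
    have he' : (fun q : ℤ × ℤ => L.coeff q.1 * x ^ q.1 * (M.coeff q.2 * x ^ q.2)) ∘ e =
        fun p => L.coeff p.2 * M.coeff (p.1 - p.2) * x ^ p.1 := funext hterm
    rwa [he'] at h'
  refine h'.prod_fiberwise (g := fun n => (L * M).coeff n * x ^ n) fun n => ?_
  simp only
  rw [coeff_mul_eq_sum_Icc ha hb, Finset.sum_mul]
  refine hasSum_sum_of_ne_finset_zero fun i hi => ?_
  rw [Finset.mem_Icc, not_and_or] at hi
  rcases hi with hi | hi
  · rw [ha i (by omega), zero_mul, zero_mul]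
  · rw [hb (n - i) (by omega), mul_zero, zero_mul]

theorem integral_exp_int_mul (k : ℤ) :
    ∫ θ in (-Real.pi)..Real.pi, Complex.exp (k * Complex.I * θ) =
      if k = 0 then 2 * (Real.pi : ℂ) else 0 := by
  split_ifs with hk
  · subst hk
    simp
    ring
  · have hk' : (k * Complex.I : ℂ) ≠ 0 := mul_ne_zero (Int.cast_ne_zero.2 hk) Complex.I_ne_zero
    rw [integral_exp_mul_complex hk']
    have : Complex.exp (k * Complex.I * (Real.pi : ℝ)) =
        Complex.exp (k * Complex.I * ((-Real.pi : ℝ) : ℂ)) := by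
      rw [Complex.exp_eq_exp_iff_exists_int]
      exact ⟨k, by push_cast; ring⟩
    rw [this, sub_self, zero_div]

/-- The residue as an integral over small circles. -/
theorem HasLaurentExpansion.exists_integral_eq {f : ℂ → ℂ} {L : Laurent ℂ}
    (hf : HasLaurentExpansion f L) :
    ∃ ε > 0, ∀ r : ℝ, 0 < r → r < ε →
      ∫ θ in (-Real.pi)..Real.pi, Complex.exp (θ * Complex.I) * f (r * Complex.exp (θ * Complex.I))
        = 2 * Real.pi * L.coeff (-1) / r := by
  obtain ⟨ε, hε, h⟩ := Metric.mem_nhdsWithin_iff.1 hf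
  refine ⟨ε, hε, fun r hr hrε => ?_⟩
  have hr' : (r : ℂ) ≠ 0 := Complex.ofReal_ne_zero.2 hr.ne'
  have hmem : ∀ θ : ℝ, HasSum (fun n : ℤ => L.coeff n * (r * Complex.exp (θ * Complex.I)) ^ n)
      (f (r * Complex.exp (θ * Complex.I))) := by
    intro θ
    refine h ⟨?_, mul_ne_zero hr' (Complex.exp_ne_zero _)⟩
    rw [mem_ball_zero_iff, norm_mul, Complex.norm_exp_ofReal_mul_I, mul_one, Complex.norm_real,
      Real.norm_of_nonneg hr.le]
    exact hrε
  have hterm : ∀ (n : ℤ) (θ : ℝ), Complex.exp (θ * Complex.I) *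
      (L.coeff n * (r * Complex.exp (θ * Complex.I)) ^ n) =
      L.coeff n * (r : ℂ) ^ n * Complex.exp ((n + 1 : ℤ) * Complex.I * θ) := by
    intro n θ
    rw [mul_zpow, ← Complex.exp_int_mul, show ((n + 1 : ℤ) * Complex.I * θ : ℂ) =
      θ * Complex.I + n * (θ * Complex.I) by push_cast; ring, Complex.exp_add]
    ring
  -- Termwise integration: on the circle the terms have absolute value independent of `θ`, and these
  -- are summable by convergence at `θ = 0`.
  have hsum := intervalIntegral.hasSum_integral_of_dominated_convergence
    (μ := MeasureTheory.volume) (a := -Real.pi) (b := Real.pi)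
    (F := fun (n : ℤ) (θ : ℝ) => Complex.exp (θ * Complex.I) *
      (L.coeff n * (r * Complex.exp (θ * Complex.I)) ^ n))
    (f := fun θ => Complex.exp (θ * Complex.I) * f (r * Complex.exp (θ * Complex.I)))
    (fun n _ => ‖L.coeff n * (r : ℂ) ^ n‖)
    (fun n => by
      simp only [hterm]
      exact Continuous.aestronglyMeasurable (by fun_prop))
    (fun n => Filter.Eventually.of_forall fun θ _ => by
      rw [hterm, norm_mul _ (Complex.exp _),
        show ((n + 1 : ℤ) * Complex.I * θ : ℂ) = (((n + 1 : ℤ) * θ : ℝ) : ℂ) * Complex.I by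
          push_cast; ring, Complex.norm_exp_ofReal_mul_I, mul_one])
    (Filter.Eventually.of_forall fun θ _ => by simpa using (hmem 0).summable.norm)
    (by simp)
    (Filter.Eventually.of_forall fun θ _ => (hmem θ).mul_left _)
  have hint : ∀ n : ℤ, ∫ θ in (-Real.pi)..Real.pi, Complex.exp (θ * Complex.I) *
      (L.coeff n * (r * Complex.exp (θ * Complex.I)) ^ n) =
        if n = -1 then 2 * Real.pi * L.coeff (-1) / r else 0 := by
    intro n
    simp only [hterm]
    rw [intervalIntegral.integral_const_mul, integral_exp_int_mul]
    by_cases hn : n = -1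
    · subst hn
      simp
      ring
    · rw [if_neg (by omega), if_neg hn, mul_zero]
  simp only [hint] at hsum
  exact hsum.unique (hasSum_ite_eq _ _)

/-! ### The operator `∂/∂x̄` and its integrals -/

/-- Twice the derivative `∂u/∂x̄`. -/
def dbar (u : ℂ → ℂ) (x : ℂ) : ℂ := fderiv ℝ u x 1 + Complex.I * fderiv ℝ u x Complex.I

theorem dbar_congr {u v : ℂ → ℂ} {x : ℂ} (h : u =ᶠ[nhds x] v) : dbar u x = dbar v x := by
  rw [dbar, dbar, h.fderiv_eq]

theorem dbar_const (c : ℂ) (x : ℂ) : dbar (fun _ => c) x = 0 := by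
  simp [dbar]

theorem dbar_mul {u v : ℂ → ℂ} {x : ℂ} (hu : DifferentiableAt ℝ u x)
    (hv : DifferentiableAt ℝ v x) :
    dbar (fun y => u y * v y) x = u x * dbar v x + v x * dbar u x := by
  rw [dbar, fderiv_fun_mul hu hv]
  simp only [dbar, add_apply, smul_apply, smul_eq_mul]
  ring

theorem dbar_eq_zero {u : ℂ → ℂ} {x : ℂ} (hu : DifferentiableAt ℂ u x) : dbar u x = 0 := by
  rw [dbar, hu.fderiv_restrictScalars ℝ]
  have : fderiv ℂ u x Complex.I = Complex.I * fderiv ℂ u x 1 := by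
    rw [← smul_eq_mul, ← map_smul, smul_eq_mul, mul_one]
  simp only [ContinuousLinearMap.coe_restrictScalars']
  rw [this, ← mul_assoc, Complex.I_mul_I]
  ring

/-- For holomorphic `τ` the real differential is multiplication by `τ'`, so `∂u/∂x̄` acquires the
conjugate of `τ'`, as the coefficient of a `(0,1)`-form should. -/
theorem dbar_comp {u τ : ℂ → ℂ} {x : ℂ} (hu : DifferentiableAt ℝ u (τ x))
    (hτ : DifferentiableAt ℂ τ x) :
    dbar (fun y => u (τ y)) x = (starRingEnd ℂ) (deriv τ x) * dbar u (τ x) := by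
  have h1 : ∀ v : ℂ, fderiv ℝ (fun y => u (τ y)) x v = fderiv ℝ u (τ x) (deriv τ x * v) := by
    intro v
    have := fderiv_fun_comp x hu (hτ.restrictScalars ℝ)
    rw [this, hτ.fderiv_restrictScalars ℝ]
    simp [mul_comm]
  have h2 : ∀ v : ℂ, fderiv ℝ u (τ x) v =
      v.re * fderiv ℝ u (τ x) 1 + v.im * fderiv ℝ u (τ x) Complex.I := by
    intro v
    conv_lhs => rw [← Complex.re_add_im v]
    rw [map_add, show (v.re : ℂ) = v.re • (1 : ℂ) by simp,
      show (v.im : ℂ) * Complex.I = v.im • Complex.I by simp, map_smul, map_smul]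
    simp
  rw [dbar, h1, h1, h2, h2 (_ * Complex.I), dbar]
  have h3 : (starRingEnd ℂ) (deriv τ x) = (deriv τ x).re - (deriv τ x).im * Complex.I := by
    apply Complex.ext <;> simp
  rw [h3]
  simp only [mul_one, Complex.mul_I_re, Complex.mul_I_im]
  push_cast
  linear_combination ((deriv τ x).im * (fderiv ℝ u (τ x)) Complex.I) * Complex.I_mul_I

/-- Integration by parts against the constant `1`, in each of the two real directions. -/
theorem integral_dbar_eq_zero {u : ℂ → ℂ} (hu : ContDiff ℝ 1 u) (hc : HasCompactSupport u) :
    ∫ x, dbar u x = 0 := by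
  have h1 : ∀ v : ℂ, MeasureTheory.Integrable (fun x => fderiv ℝ u x v) := fun v => by
    refine Continuous.integrable_of_hasCompactSupport ?_ (hc.fderiv_apply ℝ v)
    have := hu.continuous_fderiv one_ne_zero
    fun_prop
  have h2 : ∀ v : ℂ, ∫ x, fderiv ℝ u x v = 0 := fun v => by
    have := integral_mul_fderiv_eq_neg_fderiv_mul_of_integrable (μ := MeasureTheory.volume)
      (f := fun _ : ℂ => (1 : ℂ)) (g := u) (v := v) (by simp) (by simpa using h1 v)
      (by simpa using hu.continuous.integrable_of_hasCompactSupport hc)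
      (fun x _ => by fun_prop) (fun x _ => (hu.differentiable one_ne_zero) x)
    simpa using this
  simp only [dbar]
  rw [MeasureTheory.integral_add (h1 1) ((h1 Complex.I).const_mul _),
    MeasureTheory.integral_const_mul, h2, h2]
  simp

/-- The integral of a radial cutoff against a function with a Laurent expansion. -/
theorem HasLaurentExpansion.exists_integral_radial {g : ℂ → ℂ} {L : Laurent ℂ}
    (hg : HasLaurentExpansion g L) :
    ∃ ε > 0, ∀ (r₀ : ℝ) (ρ : ℝ → ℝ) (F : ℂ → ℂ), 0 < r₀ → r₀ < ε → ContDiff ℝ 1 ρ →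
      (∀ t, r₀ ^ 2 ≤ t → ρ t = 0) → Continuous F →
      (∀ x, ‖x‖ < r₀ → x ≠ 0 → F x = 2 * deriv ρ (‖x‖ ^ 2) * x * g x) →
      (∀ x, r₀ < ‖x‖ → F x = 0) →
      ∫ x, F x = -(2 * Real.pi * L.coeff (-1) * ρ 0) := by
  obtain ⟨ε, hε, hint⟩ := hg.exists_integral_eq
  refine ⟨ε, hε, fun r₀ ρ F hr₀ hr₀ε hρ hρ0 hF hFg hF0 => ?_⟩
  have hpolar : ∀ p : ℝ × ℝ, Complex.polarCoord.symm p =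
      p.1 * Complex.exp (p.2 * Complex.I) := fun p => by
    rw [Complex.polarCoord_symm_apply, Complex.exp_mul_I, Complex.ofReal_cos, Complex.ofReal_sin]
  have hnorm : ∀ (r θ : ℝ), 0 < r → ‖(r : ℂ) * Complex.exp (θ * Complex.I)‖ = r := by
    intro r θ hr
    rw [norm_mul, Complex.norm_exp_ofReal_mul_I, mul_one, Complex.norm_real,
      Real.norm_of_nonneg hr.le]
  have hinteg : MeasureTheory.IntegrableOn
      (fun p : ℝ × ℝ => p.1 • F (p.1 * Complex.exp (p.2 * Complex.I)))
      (Set.Ioi 0 ×ˢ Set.Ioo (-Real.pi) Real.pi) (MeasureTheory.volume.prod MeasureTheory.volume) := by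
    have hcont : Continuous (fun p : ℝ × ℝ => p.1 • F (p.1 * Complex.exp (p.2 * Complex.I))) := by
      fun_prop
    have hK : IsCompact (Set.Icc 0 r₀ ×ˢ Set.Icc (-Real.pi) Real.pi) :=
      isCompact_Icc.prod isCompact_Icc
    refine MeasureTheory.IntegrableOn.of_forall_sdiff_eq_zero
      (hcont.continuousOn.integrableOn_compact hK)
      (measurableSet_Ioi.prod measurableSet_Ioo) ?_
    rintro ⟨r, θ⟩ ⟨⟨hr, hθ⟩, hK⟩
    have hr' : (0 : ℝ) < r := hr
    have : r₀ < r := by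
      by_contra h
      exact hK ⟨⟨hr'.le, not_lt.1 h⟩, Set.Ioo_subset_Icc_self hθ⟩
    simp only
    rw [hF0 _ (by rwa [hnorm r θ hr']), smul_zero]
  have hderiv0 : ∀ t, r₀ ^ 2 < t → deriv ρ t = 0 := fun t ht => by
    have : ρ =ᶠ[nhds t] fun _ => 0 := by
      filter_upwards [lt_mem_nhds ht] with y hy using hρ0 y hy.le
    rw [this.deriv_eq, deriv_const]
  -- On each circle the factor `2ρ'(r²)` is constant and the angular integral of `x g` yields the
  -- residue, which leaves the radial integrand `d/dr ρ(r²)`.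
  have hinner : ∀ r ∈ Set.Ioi (0 : ℝ), r ≠ r₀ →
      ∫ θ in Set.Ioo (-Real.pi) Real.pi, r • F (r * Complex.exp (θ * Complex.I)) =
        2 * Real.pi * L.coeff (-1) * ((2 * r * deriv ρ (r ^ 2) : ℝ) : ℂ) := by
    intro r hr hne
    have hr' : (0 : ℝ) < r := hr
    rcases lt_or_gt_of_ne hne with hlt | hgt
    · have h1 : ∀ θ : ℝ, r • F (r * Complex.exp (θ * Complex.I)) =
          2 * r ^ 2 * deriv ρ (r ^ 2) * (Complex.exp (θ * Complex.I) *
            g (r * Complex.exp (θ * Complex.I))) := by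
        intro θ
        rw [hFg _ (by rwa [hnorm r θ hr'])
          (mul_ne_zero (Complex.ofReal_ne_zero.2 hr'.ne') (Complex.exp_ne_zero _)),
          hnorm r θ hr', Complex.real_smul]
        ring
      simp only [h1]
      rw [MeasureTheory.integral_const_mul, ← MeasureTheory.integral_Ioc_eq_integral_Ioo,
        ← intervalIntegral.integral_of_le (by linarith [Real.pi_pos]),
        hint r hr' (hlt.trans hr₀ε)]
      have : (r : ℂ) ≠ 0 := Complex.ofReal_ne_zero.2 hr'.ne'
      push_cast
      field_simp
    · have h1 : ∀ θ : ℝ, r • F (r * Complex.exp (θ * Complex.I)) = 0 := fun θ => by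
        rw [hF0 _ (by rwa [hnorm r θ hr']), smul_zero]
      simp only [h1]
      rw [hderiv0 _ (by gcongr)]
      simp
  have hradial : ∫ r in Set.Ioi (0 : ℝ), 2 * r * deriv ρ (r ^ 2) = -ρ 0 := by
    have h1 : ∫ r in Set.Ioi (0 : ℝ), 2 * r * deriv ρ (r ^ 2) =
        ∫ r in Set.Ioc (0 : ℝ) r₀, 2 * r * deriv ρ (r ^ 2) := by
      refine MeasureTheory.setIntegral_eq_of_subset_of_forall_sdiff_eq_zero measurableSet_Ioi
        Set.Ioc_subset_Ioi_self ?_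
      rintro r ⟨hr, hr'⟩
      have h0 : (0 : ℝ) < r := hr
      have : r₀ < r := by
        by_contra h
        exact hr' ⟨hr, not_lt.1 h⟩
      rw [hderiv0 _ (by gcongr), mul_zero]
    rw [h1, ← intervalIntegral.integral_of_le hr₀.le]
    have h2 : ∀ r ∈ Set.uIcc 0 r₀, HasDerivAt (fun r => ρ (r ^ 2)) (2 * r * deriv ρ (r ^ 2)) r := by
      intro r _
      have h3 := ((hρ.differentiable one_ne_zero) (r ^ 2)).hasDerivAt.comp r (hasDerivAt_pow 2 r)
      exact h3.congr_deriv (by push_cast; ring)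
    rw [intervalIntegral.integral_eq_sub_of_hasDerivAt h2, hρ0 _ le_rfl]
    · simp
    · refine Continuous.intervalIntegrable ?_ _ _
      have := hρ.continuous_deriv le_rfl
      fun_prop
  rw [← Complex.integral_comp_polarCoord_symm, polarCoord_target]
  simp only [hpolar]
  rw [MeasureTheory.Measure.volume_eq_prod, MeasureTheory.setIntegral_prod _ hinteg]
  -- The formulas for `F` say nothing on the circle of radius `r₀`, which is negligible.
  have hae : ∀ᵐ r : ℝ, r ≠ r₀ := by
    simp [MeasureTheory.ae_iff]
  rw [MeasureTheory.setIntegral_congr_ae (g := fun r : ℝ =>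
    2 * Real.pi * L.coeff (-1) * ((2 * r * deriv ρ (r ^ 2) : ℝ) : ℂ)) measurableSet_Ioi
    (by filter_upwards [hae] with r hr hr' using hinner r hr' hr),
    MeasureTheory.integral_const_mul, integral_complex_ofReal, hradial]
  push_cast
  ring

end GreenKernel

end

/-! ### Integration of `a ∂̄u ∧ rω` in charts: independence of the chart and local Stokes. -/

noncomputable section

namespace GreenKernel

/-! ### Complex curves as smooth real surfaces -/

/-- Complex analytic transition maps are real smooth; this gives access to smooth partitions of
unity on `X`. -/
theorem contDiffGroupoid_complex_le :
    contDiffGroupoid ω 𝓘(ℂ) ≤ contDiffGroupoid ∞ 𝓘(ℝ, ℂ) := by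
  intro e he
  replace he := (mem_groupoid_of_pregroupoid (PG := contDiffPregroupoid ω 𝓘(ℂ))).1 he
  refine (mem_groupoid_of_pregroupoid (PG := contDiffPregroupoid ∞ 𝓘(ℝ, ℂ))).2 ?_
  simp only [contDiffPregroupoid, modelWithCornersSelf_coe,
    modelWithCornersSelf_coe_symm, Function.id_comp, Function.comp_id, Set.preimage_id_eq, id_eq,
    Set.range_id, Set.inter_univ] at he ⊢
  exact ⟨(he.1.restrict_scalars ℝ).of_le (by simp), (he.2.restrict_scalars ℝ).of_le (by simp)⟩

section Surface

variable {X : Type*} [TopologicalSpace X] [ChartedSpace ℂ X]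

theorem isManifold_real [IsManifold 𝓘(ℂ) ω X] : IsManifold 𝓘(ℝ, ℂ) ∞ X :=
  { toHasGroupoid := hasGroupoid_of_le (G₁ := contDiffGroupoid ω 𝓘(ℂ)) inferInstance
      contDiffGroupoid_complex_le }

theorem mem_maximalAtlas_real {φ : OpenPartialHomeomorph X ℂ}
    (hφ : φ ∈ IsManifold.maximalAtlas 𝓘(ℂ) ω X) : φ ∈ IsManifold.maximalAtlas 𝓘(ℝ, ℂ) ∞ X :=
  fun e he => ⟨contDiffGroupoid_complex_le (hφ e he).1, contDiffGroupoid_complex_le (hφ e he).2⟩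

theorem contDiffAt_comp_symm {φ : OpenPartialHomeomorph X ℂ}
    (hφ : φ ∈ IsManifold.maximalAtlas 𝓘(ℂ) ω X) {u : X → ℂ}
    (hu : ContMDiff 𝓘(ℝ, ℂ) 𝓘(ℝ, ℂ) ∞ u) {x : ℂ} (hx : x ∈ φ.target) :
    ContDiffAt ℝ ∞ (fun y => u (φ.symm y)) x :=
  contMDiffAt_iff_contDiffAt.1 (hu.contMDiffAt.comp x
    ((contMDiffOn_symm_of_mem_maximalAtlas (mem_maximalAtlas_real hφ)).contMDiffAt
      (φ.open_target.mem_nhds hx)))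

theorem differentiableAt_comp_symm {φ : OpenPartialHomeomorph X ℂ}
    (hφ : φ ∈ IsManifold.maximalAtlas 𝓘(ℂ) ω X) {u : X → ℂ}
    (hu : ContMDiff 𝓘(ℝ, ℂ) 𝓘(ℝ, ℂ) ∞ u) {x : ℂ} (hx : x ∈ φ.target) :
    DifferentiableAt ℝ (fun y => u (φ.symm y)) x :=
  (contDiffAt_comp_symm hφ hu hx).differentiableAt (by simp)

theorem continuousAt_dbar_comp_symm {φ : OpenPartialHomeomorph X ℂ}
    (hφ : φ ∈ IsManifold.maximalAtlas 𝓘(ℂ) ω X) {u : X → ℂ}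
    (hu : ContMDiff 𝓘(ℝ, ℂ) 𝓘(ℝ, ℂ) ∞ u) {x : ℂ} (hx : x ∈ φ.target) :
    ContinuousAt (dbar fun y => u (φ.symm y)) x := by
  have h : ContinuousAt (fderiv ℝ fun y => u (φ.symm y)) x :=
    ((contDiffAt_comp_symm hφ hu hx).fderiv_right (m := 0) (by simp)).continuousAt
  unfold dbar
  fun_prop

theorem mdifferentiableAt_symm {φ : OpenPartialHomeomorph X ℂ}
    (hφ : φ ∈ IsManifold.maximalAtlas 𝓘(ℂ) ω X) {x : ℂ} (hx : x ∈ φ.target) :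
    MDifferentiableAt 𝓘(ℂ) 𝓘(ℂ) φ.symm x :=
  ((contMDiffOn_symm_of_mem_maximalAtlas hφ).contMDiffAt
    (φ.open_target.mem_nhds hx)).mdifferentiableAt (by simp)

theorem differentiableAt_transition {φ ψ : OpenPartialHomeomorph X ℂ}
    (hφ : φ ∈ IsManifold.maximalAtlas 𝓘(ℂ) ω X) (hψ : ψ ∈ IsManifold.maximalAtlas 𝓘(ℂ) ω X)
    {x : ℂ} (hx : x ∈ φ.target) (hx' : φ.symm x ∈ ψ.source) :
    DifferentiableAt ℂ (fun y => ψ (φ.symm y)) x :=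
  mdifferentiableAt_iff_differentiableAt.1
    ((((contMDiffOn_of_mem_maximalAtlas hψ).contMDiffAt
      (ψ.open_source.mem_nhds hx')).mdifferentiableAt (by simp)).comp x
        (mdifferentiableAt_symm hφ hx))

theorem eventually_symm_mem_source {X : Type*} [TopologicalSpace X] {φ ψ : OpenPartialHomeomorph X ℂ}
    {x : ℂ} (hx : x ∈ φ.target) (hx' : φ.symm x ∈ ψ.source) :
    ∀ᶠ y in nhds x, φ.symm y ∈ ψ.source :=
  (φ.symm.continuousAt hx).eventually (ψ.open_source.mem_nhds hx')

theorem localCoeff_transition (η : (p : X) → (TangentSpace 𝓘(ℂ) p →L[ℂ] ℂ))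
    {φ ψ : OpenPartialHomeomorph X ℂ}
    (hφ : φ ∈ IsManifold.maximalAtlas 𝓘(ℂ) ω X) (hψ : ψ ∈ IsManifold.maximalAtlas 𝓘(ℂ) ω X)
    {x : ℂ} (hx : x ∈ φ.target) (hx' : φ.symm x ∈ ψ.source) :
    localCoeff η φ x =
      deriv (fun y => ψ (φ.symm y)) x * localCoeff η ψ (ψ (φ.symm x)) := by
  -- The type of `η p` depends on `p`, although every tangent space is `ℂ`; covectors at
  -- propositionally equal points are compared through their values.
  have hpt : ∀ (p q : X) (v : ℂ), p = q → (η p : ℂ →L[ℂ] ℂ) v = (η q : ℂ →L[ℂ] ℂ) v := by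
    rintro p q v rfl
    rfl
  have hτ := differentiableAt_transition hφ hψ hx hx'
  have h1 : φ.symm =ᶠ[nhds x] ψ.symm ∘ fun y => ψ (φ.symm y) := by
    filter_upwards [eventually_symm_mem_source hx hx'] with y hy
    exact (ψ.left_inv hy).symm
  obtain ⟨A, hA⟩ : ∃ A : ℂ →L[ℂ] ℂ, A = mfderiv 𝓘(ℂ) 𝓘(ℂ) φ.symm x := ⟨_, rfl⟩
  obtain ⟨B, hB⟩ : ∃ B : ℂ →L[ℂ] ℂ, B = mfderiv 𝓘(ℂ) 𝓘(ℂ) ψ.symm (ψ (φ.symm x)) := ⟨_, rfl⟩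
  have h2 : A = B.comp (fderiv ℂ (fun y => ψ (φ.symm y)) x) := by
    rw [hA, hB, ← mfderiv_eq_fderiv]
    exact h1.mfderiv_eq.trans (mfderiv_comp x (mdifferentiableAt_symm hψ (ψ.map_source hx'))
      (mdifferentiableAt_iff_differentiableAt.2 hτ))
  have h3 : A 1 = deriv (fun y => ψ (φ.symm y)) x • B 1 := by
    rw [h2, ContinuousLinearMap.comp_apply, ← map_smul, fderiv_apply_one_eq_deriv, smul_eq_mul,
      mul_one]
  have h4 : localCoeff η φ x = (η (φ.symm x) : ℂ →L[ℂ] ℂ) (A 1) := by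
    rw [hA]
    rfl
  have h5 : localCoeff η ψ (ψ (φ.symm x)) =
      (η (ψ.symm (ψ (φ.symm x))) : ℂ →L[ℂ] ℂ) (B 1) := by
    rw [hB]
    rfl
  rw [h4, h5, h3, hpt _ (ψ.symm (ψ (φ.symm x))) _ (ψ.left_inv hx').symm]
  exact ContinuousLinearMap.map_smul (η (ψ.symm (ψ (φ.symm x))) : ℂ →L[ℂ] ℂ) _ _

end Surface

/-! ### Stokes' theorem on a complex curve -/

namespace MarkedCurve

section Stokes

variable {X : Type*} [TopologicalSpace X] [ChartedSpace ℂ X] [IsManifold 𝓘(ℂ) ω X]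
  (C : MarkedCurve X) (r : X → ℂ)

/-- The coefficient of the differential `r ω` in a chart. -/
def coeffIn (φ : OpenPartialHomeomorph X ℂ) (x : ℂ) : ℂ :=
  r (φ.symm x) * localCoeff C.form φ x

/-- The density of the integral of `a ∂̄u ∧ r ω` in a chart, up to a constant factor. -/
def density (φ : OpenPartialHomeomorph X ℂ) (a u : X → ℂ) : ℂ → ℂ :=
  φ.target.indicator fun x => a (φ.symm x) * dbar (fun y => u (φ.symm y)) x * C.coeffIn r φ x

variable {C r}

theorem coeffIn_transition {φ ψ : OpenPartialHomeomorph X ℂ}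
    (hφ : φ ∈ IsManifold.maximalAtlas 𝓘(ℂ) ω X) (hψ : ψ ∈ IsManifold.maximalAtlas 𝓘(ℂ) ω X)
    {x : ℂ} (hx : x ∈ φ.target) (hx' : φ.symm x ∈ ψ.source) :
    C.coeffIn r φ x = deriv (fun y => ψ (φ.symm y)) x * C.coeffIn r ψ (ψ (φ.symm x)) := by
  rw [coeffIn, coeffIn, localCoeff_transition C.form hφ hψ hx hx', ψ.left_inv hx']
  ring

theorem analyticAt_coeffIn [T2Space X] (hr : MDifferentiableOn 𝓘(ℂ) 𝓘(ℂ) r (C.S : Set X)ᶜ)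
    {φ : OpenPartialHomeomorph X ℂ} (hφ : φ ∈ IsManifold.maximalAtlas 𝓘(ℂ) ω X)
    {x : ℂ} (hx : x ∈ φ.target) (hxS : φ.symm x ∉ C.S) : AnalyticAt ℂ (C.coeffIn r φ) x := by
  have hopen : IsOpen (C.S : Set X)ᶜ := C.S.finite_toSet.isClosed.isOpen_compl
  have h1 : DifferentiableOn ℂ (fun y => r (φ.symm y)) (φ.target ∩ φ.symm ⁻¹' (C.S : Set X)ᶜ) :=
    fun y hy => (mdifferentiableAt_iff_differentiableAt.1
      (((hr _ hy.2).mdifferentiableAt (hopen.mem_nhds hy.2)).comp y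
        (mdifferentiableAt_symm hφ hy.1))).differentiableWithinAt
  have h2 := h1.analyticAt ((φ.isOpen_inter_preimage_symm hopen).mem_nhds ⟨hx, hxS⟩)
  have h3 := (C.form_regular _ hxS φ hφ (φ.map_target hx)).1
  rw [φ.right_inv hx] at h3
  exact h2.mul h3

theorem density_of_mem {φ : OpenPartialHomeomorph X ℂ} {a u : X → ℂ} {x : ℂ}
    (hx : x ∈ φ.target) : C.density r φ a u x =
      a (φ.symm x) * dbar (fun y => u (φ.symm y)) x * C.coeffIn r φ x :=
  Set.indicator_of_mem hx _

theorem density_of_notMem {φ : OpenPartialHomeomorph X ℂ} {a u : X → ℂ} {x : ℂ}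
    (hx : x ∉ φ.target) : C.density r φ a u x = 0 :=
  Set.indicator_of_notMem hx _

theorem density_eq_zero_of_eventually {φ : OpenPartialHomeomorph X ℂ} {a u : X → ℂ} {x : ℂ}
    {c : ℂ} (hu : ∀ᶠ p in nhds (φ.symm x), u p = c) : C.density r φ a u x = 0 := by
  by_cases hx : x ∈ φ.target
  · have h : (fun y => u (φ.symm y)) =ᶠ[nhds x] fun _ => c :=
      (φ.symm.continuousAt hx).eventually hu
    rw [density_of_mem hx, dbar_congr h, dbar_const]
    ring
  · exact density_of_notMem hx

theorem density_eq_zero {φ : OpenPartialHomeomorph X ℂ} {a u : X → ℂ} {x : ℂ}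
    (hx : x ∉ φ.target ∩ φ.symm ⁻¹' (tsupport a ∩ tsupport u)) : C.density r φ a u x = 0 := by
  by_cases hxt : x ∈ φ.target
  · by_cases ha : φ.symm x ∈ tsupport a
    · have hu : φ.symm x ∉ tsupport u := fun hu => hx ⟨hxt, ha, hu⟩
      exact density_eq_zero_of_eventually (c := 0) (notMem_tsupport_iff_eventuallyEq.1 hu)
    · rw [density_of_mem hxt, image_eq_zero_of_notMem_tsupport ha]
      ring
  · exact density_of_notMem hxt

theorem isCompact_target_inter {X : Type*} [TopologicalSpace X] [CompactSpace X] {φ : OpenPartialHomeomorph X ℂ} {K : Set X}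
    (hK : IsClosed K) (hKφ : K ⊆ φ.source) : IsCompact (φ.target ∩ φ.symm ⁻¹' K) := by
  rw [← φ.image_eq_target_inter_inv_preimage hKφ]
  exact hK.isCompact.image_of_continuousOn (φ.continuousOn.mono hKφ)

/-- The only danger is at `S`, where `rω` may have poles; `u` is locally constant there, so `∂̄u`
vanishes near them. -/
theorem continuous_density [T2Space X] [CompactSpace X]
    (hr : MDifferentiableOn 𝓘(ℂ) 𝓘(ℂ) r (C.S : Set X)ᶜ)
    {φ : OpenPartialHomeomorph X ℂ} (hφ : φ ∈ IsManifold.maximalAtlas 𝓘(ℂ) ω X) {a u : X → ℂ}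
    (ha : Continuous a) (hu : ContMDiff 𝓘(ℝ, ℂ) 𝓘(ℝ, ℂ) ∞ u)
    (hK : tsupport a ∩ tsupport u ⊆ φ.source)
    (hS : ∀ s ∈ C.S, ∃ c, ∀ᶠ p in nhds s, u p = c) : Continuous (C.density r φ a u) := by
  refine continuous_iff_continuousAt.2 fun x => ?_
  by_cases hx : x ∈ φ.target
  · by_cases hxS : φ.symm x ∈ C.S
    · obtain ⟨c, hc⟩ := hS _ hxS
      have h : C.density r φ a u =ᶠ[nhds x] fun _ => 0 := by
        filter_upwards [(φ.symm.continuousAt hx).eventually hc.eventually_nhds] with y hy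
        exact density_eq_zero_of_eventually hy
      exact continuousAt_const.congr h.symm
    · have h : C.density r φ a u =ᶠ[nhds x] fun x =>
          a (φ.symm x) * dbar (fun y => u (φ.symm y)) x * C.coeffIn r φ x := by
        filter_upwards [φ.open_target.mem_nhds hx] with y hy using density_of_mem hy
      refine ContinuousAt.congr ?_ h.symm
      exact ((ha.continuousAt.comp (φ.symm.continuousAt hx)).mul
        (continuousAt_dbar_comp_symm hφ hu hx)).mul (analyticAt_coeffIn hr hφ hx hxS).continuousAt
  · have hc := isCompact_target_inter ((isClosed_tsupport a).inter (isClosed_tsupport u)) hK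
    have h : C.density r φ a u =ᶠ[nhds x] fun _ => 0 := by
      filter_upwards [hc.isClosed.isOpen_compl.mem_nhds fun h => hx h.1] with y hy
      exact density_eq_zero hy
    exact continuousAt_const.congr h.symm

theorem integrable_density [T2Space X] [CompactSpace X]
    (hr : MDifferentiableOn 𝓘(ℂ) 𝓘(ℂ) r (C.S : Set X)ᶜ)
    {φ : OpenPartialHomeomorph X ℂ} (hφ : φ ∈ IsManifold.maximalAtlas 𝓘(ℂ) ω X) {a u : X → ℂ}
    (ha : Continuous a) (hu : ContMDiff 𝓘(ℝ, ℂ) 𝓘(ℝ, ℂ) ∞ u)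
    (hK : tsupport a ∩ tsupport u ⊆ φ.source)
    (hS : ∀ s ∈ C.S, ∃ c, ∀ᶠ p in nhds s, u p = c) :
    MeasureTheory.Integrable (C.density r φ a u) :=
  (continuous_density hr hφ ha hu hK hS).integrable_of_hasCompactSupport
    (HasCompactSupport.intro
      (isCompact_target_inter ((isClosed_tsupport a).inter (isClosed_tsupport u)) hK)
      fun _ hx => density_eq_zero hx)

/-- The integral of the density does not depend on the chart. -/
theorem integral_density_eq {φ ψ : OpenPartialHomeomorph X ℂ}
    (hφ : φ ∈ IsManifold.maximalAtlas 𝓘(ℂ) ω X) (hψ : ψ ∈ IsManifold.maximalAtlas 𝓘(ℂ) ω X)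
    {a u : X → ℂ} (hu : ContMDiff 𝓘(ℝ, ℂ) 𝓘(ℝ, ℂ) ∞ u)
    (hKφ : tsupport a ∩ tsupport u ⊆ φ.source) (hKψ : tsupport a ∩ tsupport u ⊆ ψ.source) :
    ∫ x, C.density r φ a u x = ∫ x, C.density r ψ a u x := by
  set U : Set ℂ := φ.target ∩ φ.symm ⁻¹' ψ.source with hU
  set V : Set ℂ := ψ.target ∩ ψ.symm ⁻¹' φ.source with hV
  set τ : ℂ → ℂ := fun y => ψ (φ.symm y) with hτ
  have hUV : τ '' U = V := by
    ext y
    constructor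
    · rintro ⟨x, ⟨hx, hx'⟩, rfl⟩
      refine ⟨ψ.map_source hx', ?_⟩
      rw [Set.mem_preimage, hτ, ψ.left_inv hx']
      exact φ.map_target hx
    · rintro ⟨hy, hy'⟩
      refine ⟨φ (ψ.symm y), ⟨φ.map_source hy', ?_⟩, ?_⟩
      · rw [Set.mem_preimage, φ.left_inv hy']
        exact ψ.map_target hy
      · simp only [hτ]
        rw [φ.left_inv hy', ψ.right_inv hy]
  have hinj : Set.InjOn τ U := by
    rintro x ⟨hx, hx'⟩ y ⟨hy, hy'⟩ h
    exact φ.symm.injOn hx hy (ψ.injOn hx' hy' h)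
  have hdiff : ∀ x ∈ U, DifferentiableAt ℂ τ x := fun x hx =>
    differentiableAt_transition hφ hψ hx.1 hx.2
  have hfderiv : ∀ x ∈ U, HasFDerivWithinAt τ ((fderiv ℂ τ x).restrictScalars ℝ) U x :=
    fun x hx => ((hdiff x hx).hasFDerivAt.restrictScalars ℝ).hasFDerivWithinAt
  have hdet : ∀ x, ((fderiv ℂ τ x).restrictScalars ℝ).det = Complex.normSq (deriv τ x) := by
    intro x
    rw [ContinuousLinearMap.det, ContinuousLinearMap.coe_restrictScalars,
      LinearMap.det_restrictScalars, Algebra.norm_complex_apply]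
    congr 1
    rw [← fderiv_apply_one_eq_deriv]
    simp
  -- The conjugate of `τ'` from `∂̄u` and the factor `τ'` from `rω` multiply to `|τ'|²`, the real
  -- Jacobian of `τ`.
  have hpt : ∀ x ∈ U, C.density r φ a u x = |((fderiv ℂ τ x).restrictScalars ℝ).det| •
      C.density r ψ a u (τ x) := by
    rintro x hx
    have hτx : τ x ∈ ψ.target := ψ.map_source hx.2
    have h1 : (fun y => u (φ.symm y)) =ᶠ[nhds x] fun y => (fun z => u (ψ.symm z)) (τ y) := by
      filter_upwards [eventually_symm_mem_source hx.1 hx.2] with y hy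
      simp only [hτ]
      rw [ψ.left_inv hy]
    rw [hdet, abs_of_nonneg (Complex.normSq_nonneg _), density_of_mem hx.1, density_of_mem hτx,
      dbar_congr h1, dbar_comp (differentiableAt_comp_symm hψ hu hτx) (hdiff x hx),
      coeffIn_transition hφ hψ hx.1 hx.2, show ψ.symm (τ x) = φ.symm x from ψ.left_inv hx.2,
      Complex.real_smul, Complex.normSq_eq_conj_mul_self]
    ring
  have hUm : MeasurableSet U := (φ.isOpen_inter_preimage_symm ψ.open_source).measurableSet
  calc ∫ x, C.density r φ a u x = ∫ x in U, C.density r φ a u x :=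
        (MeasureTheory.setIntegral_eq_integral_of_forall_compl_eq_zero (s := U) fun x hx =>
          density_eq_zero fun h => hx ⟨h.1, hKψ h.2⟩).symm
    _ = ∫ x in U, |((fderiv ℂ τ x).restrictScalars ℝ).det| • C.density r ψ a u (τ x) :=
        MeasureTheory.setIntegral_congr_fun hUm hpt
    _ = ∫ x in τ '' U, C.density r ψ a u x :=
        (MeasureTheory.integral_image_eq_integral_abs_det_fderiv_smul _ hUm hfderiv hinj _).symm
    _ = ∫ x, C.density r ψ a u x := by
        rw [hUV]
        exact MeasureTheory.setIntegral_eq_integral_of_forall_compl_eq_zero (s := V) fun x hx =>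
          density_eq_zero fun h => hx ⟨h.1, hKφ h.2⟩

/-- Stokes' theorem for forms with support in a chart. -/
theorem integral_density_one_eq_zero [T2Space X] [CompactSpace X]
    (hr : MDifferentiableOn 𝓘(ℂ) 𝓘(ℂ) r (C.S : Set X)ᶜ)
    {φ : OpenPartialHomeomorph X ℂ} (hφ : φ ∈ IsManifold.maximalAtlas 𝓘(ℂ) ω X) {u : X → ℂ}
    (hu : ContMDiff 𝓘(ℝ, ℂ) 𝓘(ℝ, ℂ) ∞ u) (hK : tsupport u ⊆ φ.source)
    (hS : ∀ s ∈ C.S, ∀ᶠ p in nhds s, u p = 0) : ∫ x, C.density r φ (fun _ => 1) u x = 0 := by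
  set v : ℂ → ℂ := φ.target.indicator fun x => u (φ.symm x) * C.coeffIn r φ x with hv
  have hcpt := isCompact_target_inter (isClosed_tsupport u) hK
  have hv0 : ∀ x ∉ φ.target ∩ φ.symm ⁻¹' tsupport u, v x = 0 := by
    intro x hx
    by_cases hxt : x ∈ φ.target
    · rw [hv, Set.indicator_of_mem hxt, image_eq_zero_of_notMem_tsupport fun h => hx ⟨hxt, h⟩,
        zero_mul]
    · exact Set.indicator_of_notMem hxt _
  have hvt : ∀ x ∉ φ.target, v =ᶠ[nhds x] fun _ => 0 := by
    intro x hx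
    filter_upwards [hcpt.isClosed.isOpen_compl.mem_nhds fun h => hx h.1] with y hy using hv0 y hy
  have hvS : ∀ x ∈ φ.target, φ.symm x ∈ C.S → v =ᶠ[nhds x] fun _ => 0 := by
    intro x hx hxS
    filter_upwards [(φ.symm.continuousAt hx).eventually (hS _ hxS),
      φ.open_target.mem_nhds hx] with y hy hyt
    rw [hv, Set.indicator_of_mem hyt, hy, zero_mul]
  have hvm : ∀ x ∈ φ.target, v =ᶠ[nhds x] fun x => u (φ.symm x) * C.coeffIn r φ x := by
    intro x hx
    filter_upwards [φ.open_target.mem_nhds hx] with y hy using Set.indicator_of_mem hy _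
  have hvdiff : ContDiff ℝ 1 v := by
    refine contDiff_iff_contDiffAt.2 fun x => ?_
    by_cases hx : x ∈ φ.target
    · by_cases hxS : φ.symm x ∈ C.S
      · exact contDiffAt_const.congr_of_eventuallyEq (hvS x hx hxS)
      · refine ContDiffAt.congr_of_eventuallyEq ?_ (hvm x hx)
        exact ((contDiffAt_comp_symm hφ hu hx).of_le (by simp)).mul
          ((analyticAt_coeffIn hr hφ hx hxS).contDiffAt.restrict_scalars ℝ)
    · exact contDiffAt_const.congr_of_eventuallyEq (hvt x hx)
  -- Off `S` the coefficient of `rω` is holomorphic, so `∂̄` of the product falls on `u` alone; near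
  -- `S` both sides vanish.
  have hdens : ∀ x, C.density r φ (fun _ => 1) u x = dbar v x := by
    intro x
    by_cases hx : x ∈ φ.target
    · by_cases hxS : φ.symm x ∈ C.S
      · rw [density_eq_zero_of_eventually (hS _ hxS), dbar_congr (hvS x hx hxS), dbar_const]
      · have hg := (analyticAt_coeffIn hr hφ hx hxS).differentiableAt
        rw [density_of_mem hx, dbar_congr (hvm x hx),
          dbar_mul (differentiableAt_comp_symm hφ hu hx) (hg.restrictScalars ℝ), dbar_eq_zero hg]
        ring
    · rw [density_of_notMem hx, dbar_congr (hvt x hx), dbar_const]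
  simp only [hdens]
  exact integral_dbar_eq_zero hvdiff (HasCompactSupport.intro hcpt hv0)

end Stokes

end MarkedCurve

end GreenKernel

end

/-! ### The residue theorem, and the isotropy of `R`. -/

noncomputable section

namespace GreenKernel

theorem dbar_radial {ρ : ℝ → ℝ} (hρ : Differentiable ℝ ρ) (x : ℂ) :
    dbar (fun y => (ρ (‖y‖ ^ 2) : ℂ)) x = 2 * deriv ρ (‖x‖ ^ 2) * x := by
  have h := Complex.ofRealCLM.hasFDerivAt.comp x
    ((hρ (‖x‖ ^ 2)).hasDerivAt.comp_hasFDerivAt x (hasStrictFDerivAt_norm_sq x).hasFDerivAt)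
  have h' : fderiv ℝ (fun y : ℂ => (ρ (‖y‖ ^ 2) : ℂ)) x = _ := h.fderiv
  rw [dbar, h']
  apply Complex.ext
  · simp [Complex.inner]
    ring
  · simp [Complex.inner]
    ring

theorem dbar_sum {ι : Type*} (J : Finset ι) {u : ι → ℂ → ℂ} {x : ℂ}
    (hu : ∀ i ∈ J, DifferentiableAt ℝ (u i) x) :
    dbar (fun y => ∑ i ∈ J, u i y) x = ∑ i ∈ J, dbar (u i) x := by
  simp only [dbar]
  rw [fderiv_fun_sum hu, Finset.sum_add_distrib, ← Finset.mul_sum]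
  simp

theorem dbar_const_sub (c : ℂ) (u : ℂ → ℂ) (x : ℂ) :
    dbar (fun y => c - u y) x = -dbar u x := by
  simp only [dbar, fderiv_const_sub, neg_apply]
  ring

namespace MarkedCurve

variable {X : Type*} [TopologicalSpace X] [ChartedSpace ℂ X] [IsManifold 𝓘(ℂ) ω X]
  {C : MarkedCurve X} {r : X → ℂ}

theorem density_sum_left {ι : Type*} (J : Finset ι) (φ : OpenPartialHomeomorph X ℂ)
    (a : ι → X → ℂ) (u : X → ℂ) (x : ℂ) :
    C.density r φ (fun p => ∑ i ∈ J, a i p) u x = ∑ i ∈ J, C.density r φ (a i) u x := by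
  by_cases hx : x ∈ φ.target
  · simp only [density_of_mem hx, Finset.sum_mul]
  · simp only [density_of_notMem hx, Finset.sum_const_zero]

theorem density_sum_right {ι : Type*} (J : Finset ι) {φ : OpenPartialHomeomorph X ℂ}
    (hφ : φ ∈ IsManifold.maximalAtlas 𝓘(ℂ) ω X) (a : X → ℂ) {u : ι → X → ℂ}
    (hu : ∀ i, ContMDiff 𝓘(ℝ, ℂ) 𝓘(ℝ, ℂ) ∞ (u i)) (x : ℂ) :
    C.density r φ a (fun p => ∑ i ∈ J, u i p) x = ∑ i ∈ J, C.density r φ a (u i) x := by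
  by_cases hx : x ∈ φ.target
  · simp only [density_of_mem hx]
    rw [dbar_sum J fun i _ => differentiableAt_comp_symm hφ (hu i) hx, Finset.mul_sum,
      Finset.sum_mul]
  · simp only [density_of_notMem hx, Finset.sum_const_zero]

theorem density_const_sub (φ : OpenPartialHomeomorph X ℂ) (a : X → ℂ) (c : ℂ) (u : X → ℂ)
    (x : ℂ) : C.density r φ a (fun p => c - u p) x = -C.density r φ a u x := by
  by_cases hx : x ∈ φ.target
  · simp only [density_of_mem hx]
    rw [dbar_const_sub]
    ring
  · simp only [density_of_notMem hx, neg_zero]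

/-- A cutoff function at a marked point, which computes the residue. -/
theorem exists_cutoff [T2Space X] [CompactSpace X]
    (hr : MDifferentiableOn 𝓘(ℂ) 𝓘(ℂ) r (C.S : Set X)ᶜ) (s : C.S) {L : Laurent ℂ}
    (hL : HasLaurentExpansion (C.coeffIn r (C.coord s)) L) :
    ∃ χ : X → ℂ, ContMDiff 𝓘(ℝ, ℂ) 𝓘(ℝ, ℂ) ∞ χ ∧ tsupport χ ⊆ (C.coord s).source ∧
      (∀ᶠ p in nhds (s : X), χ p = 1) ∧
      (∀ t ∈ C.S, t ≠ s → ∀ᶠ p in nhds t, χ p = 0) ∧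
      ∫ x, C.density r (C.coord s) (fun _ => 1) χ x = -(2 * Real.pi * L.coeff (-1)) := by
  set φ := C.coord s with hφ
  obtain ⟨ε, hε, hint⟩ := hL.exists_integral_radial
  obtain ⟨ε', hε', hball⟩ := Metric.eventually_nhds_iff_ball.1
    ((C.eventually_mem_target s).and (C.eventually_symm_notMem s))
  obtain ⟨r₀, hr₀, hr₀ε, hr₀ε'⟩ : ∃ r₀ > 0, r₀ < ε ∧ r₀ < ε' := by
    obtain ⟨r₀, h1, h2⟩ := exists_between (lt_min hε hε')
    exact ⟨r₀, h1, (lt_min_iff.1 h2).1, (lt_min_iff.1 h2).2⟩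
  have hsub : ∀ x ∈ Metric.closedBall (0 : ℂ) r₀, x ∈ φ.target ∧ (x ≠ 0 → φ.symm x ∉ C.S) :=
    fun x hx => hball x (Metric.closedBall_subset_ball hr₀ε' hx)
  have hsq : (0 : ℝ) < r₀ ^ 2 := by positivity
  -- As a function of `t = |x|²` this equals `1` for `t ≤ r₀²/2` and `0` for `t ≥ r₀²`. The
  -- resulting cutoff is constant near `s` and supported in a disc that contains no other marked
  -- point.
  set ρ : ℝ → ℝ := fun t => Real.smoothTransition (2 - 2 * t / r₀ ^ 2) with hρ
  have hρsmooth : ContDiff ℝ ∞ ρ := Real.smoothTransition.contDiff.comp (by fun_prop)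
  have hρ0 : ∀ t, r₀ ^ 2 ≤ t → ρ t = 0 := fun t ht => by
    refine Real.smoothTransition.zero_of_nonpos ?_
    have : 2 ≤ 2 * t / r₀ ^ 2 := by
      rw [le_div_iff₀ hsq]
      linarith
    linarith
  have hρ1 : ∀ t, t < r₀ ^ 2 / 2 → ρ t = 1 := fun t ht => by
    refine Real.smoothTransition.one_of_one_le ?_
    have : 2 * t / r₀ ^ 2 ≤ 1 := by
      rw [div_le_one hsq]
      linarith
    linarith
  set cut : ℂ → ℂ := fun x => (ρ (‖x‖ ^ 2) : ℂ) with hcut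
  have hcutsmooth : ContDiff ℝ ∞ cut :=
    Complex.ofRealCLM.contDiff.comp (hρsmooth.comp (contDiff_norm_sq ℝ))
  set χ : X → ℂ := φ.source.indicator fun p => cut (φ p) with hχ
  set B : Set X := φ.symm '' Metric.closedBall (0 : ℂ) r₀ with hB
  have hBclosed : IsClosed B := ((isCompact_closedBall (0 : ℂ) r₀).image_of_continuousOn
    (φ.symm.continuousOn.mono fun x hx => (hsub x hx).1)).isClosed
  have hχ0 : ∀ p ∉ B, χ p = 0 := by
    intro p hp
    by_cases hps : p ∈ φ.source
    · rw [hχ, Set.indicator_of_mem hps, hcut]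
      have : r₀ < ‖φ p‖ := by
        by_contra h
        exact hp ⟨φ p, mem_closedBall_zero_iff.2 (not_lt.1 h), φ.left_inv hps⟩
      simp only
      rw [hρ0 _ (by gcongr), Complex.ofReal_zero]
    · exact Set.indicator_of_notMem hps _
  have hχB : tsupport χ ⊆ B := by
    refine closure_minimal (fun p hp => ?_) hBclosed
    by_contra h
    exact hp (hχ0 p h)
  have hBs : B ⊆ φ.source := by
    rintro _ ⟨x, hx, rfl⟩
    exact φ.map_target (hsub x hx).1
  have hχmem : ∀ p ∈ φ.source, χ =ᶠ[nhds p] cut ∘ φ := by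
    intro p hp
    filter_upwards [φ.open_source.mem_nhds hp] with q hq using Set.indicator_of_mem hq _
  have hχsmooth : ContMDiff 𝓘(ℝ, ℂ) 𝓘(ℝ, ℂ) ∞ χ := by
    refine contMDiff_of_tsupport fun p hp => ?_
    have hps := hBs (hχB hp)
    exact (hcutsmooth.contMDiff.contMDiffAt.comp p
      ((contMDiffOn_of_mem_maximalAtlas (mem_maximalAtlas_real (C.coord_mem s))).contMDiffAt
        (φ.open_source.mem_nhds hps))).congr_of_eventuallyEq (hχmem p hps)
  have hχs : ∀ᶠ p in nhds (s : X), χ p = 1 := by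
    have hcont : ContinuousAt (fun p => ‖φ p‖ ^ 2) (s : X) :=
      ((φ.continuousAt (C.mem_source s)).norm).pow 2
    have h0 : ‖φ (s : X)‖ ^ 2 < r₀ ^ 2 / 2 := by
      rw [hφ, C.coord_self, norm_zero, zero_pow two_ne_zero]
      positivity
    filter_upwards [hcont.eventually (gt_mem_nhds h0), hχmem _ (C.mem_source s)] with p hp hp'
    rw [hp', Function.comp_apply, hcut]
    simp only
    rw [hρ1 _ hp, Complex.ofReal_one]
  have hχt : ∀ t ∈ C.S, t ≠ s → ∀ᶠ p in nhds t, χ p = 0 := by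
    intro t ht hts
    have : t ∉ B := by
      rintro ⟨x, hx, rfl⟩
      by_cases hx0 : x = 0
      · exact hts (by rw [hx0, hφ, C.coord_symm_zero])
      · exact (hsub x hx).2 hx0 ht
    filter_upwards [hBclosed.isOpen_compl.mem_nhds this] with p hp using hχ0 p hp
  refine ⟨χ, hχsmooth, hχB.trans hBs, hχs, hχt, ?_⟩
  have hcont : Continuous (C.density r φ (fun _ => 1) χ) := by
    refine continuous_density hr (C.coord_mem s) continuous_const hχsmooth
      (Set.inter_subset_right.trans (hχB.trans hBs)) fun t ht => ?_
    by_cases hts : t = s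
    · exact ⟨1, hts ▸ hχs⟩
    · exact ⟨0, hχt t ht hts⟩
  rw [hint r₀ ρ _ hr₀ hr₀ε (hρsmooth.of_le (by simp)) hρ0 hcont, hρ1 0 (by positivity),
    Complex.ofReal_one, mul_one]
  · intro x hx hx0
    have hxt := (hsub x (mem_closedBall_zero_iff.2 hx.le)).1
    have h : (fun y => χ (φ.symm y)) =ᶠ[nhds x] cut := by
      filter_upwards [φ.open_target.mem_nhds hxt] with y hy
      rw [hχ, Set.indicator_of_mem (φ.map_target hy), φ.right_inv hy]
    rw [density_of_mem hxt, dbar_congr h, hcut,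
      dbar_radial (hρsmooth.differentiable (by simp)), one_mul]
  · intro x hx
    refine density_eq_zero fun h => ?_
    obtain ⟨y, hy, hyx⟩ := hχB h.2.2
    have := φ.symm.injOn (hsub y hy).1 h.1 hyx
    rw [← this] at hx
    exact absurd (mem_closedBall_zero_iff.1 hy) (not_le.2 hx)

/-- The residue theorem on a compact complex curve. -/
theorem sum_residues_eq_zero [T2Space X] [CompactSpace X]
    (hr : MDifferentiableOn 𝓘(ℂ) 𝓘(ℂ) r (C.S : Set X)ᶜ) {L : C.S → Laurent ℂ}
    (hL : ∀ s, HasLaurentExpansion (C.coeffIn r (C.coord s)) (L s)) :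
    ∑ s, (L s).coeff (-1) = 0 := by
  classical
  have : IsManifold 𝓘(ℝ, ℂ) ∞ X := isManifold_real
  obtain ⟨T, hT⟩ := CompactSpace.elim_nhds_subcover (fun p : X => (chartAt ℂ p).source)
    fun p => (chartAt ℂ p).open_source.mem_nhds (mem_chart_source ℂ p)
  obtain ⟨ρ, hρ⟩ := SmoothPartitionOfUnity.exists_isSubordinate 𝓘(ℝ, ℂ) (isClosed_univ (X := X))
    (fun k : T => (chartAt ℂ k.1).source) (fun k => (chartAt ℂ k.1).open_source) (by
      rw [← Set.top_eq_univ, ← hT]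
      intro p hp
      obtain ⟨k, hk, hp⟩ := Set.mem_iUnion₂.1 hp
      exact Set.mem_iUnion.2 ⟨⟨k, hk⟩, hp⟩)
  set φ : T → OpenPartialHomeomorph X ℂ := fun k => chartAt ℂ k.1 with hφdef
  have hφ : ∀ k, φ k ∈ IsManifold.maximalAtlas 𝓘(ℂ) ω X := fun k =>
    IsManifold.chart_mem_maximalAtlas k.1
  set a : T → X → ℂ := fun k p => (ρ k p : ℂ) with ha
  have hasmooth : ∀ k, ContMDiff 𝓘(ℝ, ℂ) 𝓘(ℝ, ℂ) ∞ (a k) := fun k =>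
    Complex.ofRealCLM.contDiff.contMDiff.comp (ρ k).contMDiff
  have hacont : ∀ k, Continuous (a k) := fun k => (hasmooth k).continuous
  have hasupp : ∀ k, tsupport (a k) ⊆ (φ k).source := fun k => by
    refine (closure_mono fun p hp => ?_).trans (hρ k)
    intro h
    exact hp (by simp [ha, h])
  have hasum : ∀ p, ∑ k, a k p = 1 := fun p => by
    have := ρ.sum_eq_one (Set.mem_univ p)
    rw [finsum_eq_sum_of_fintype] at this
    rw [ha, ← Complex.ofReal_sum, this, Complex.ofReal_one]
  choose χ hχsmooth hχsupp hχs hχt hχint using fun s => exists_cutoff hr s (hL s)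
  have hχconst : ∀ (s : C.S), ∀ t ∈ C.S, ∃ c, ∀ᶠ p in nhds t, χ s p = c := by
    intro s t ht
    by_cases hts : t = s
    · exact ⟨1, hts ▸ hχs s⟩
    · exact ⟨0, hχt s t ht hts⟩
  -- `f` vanishes near every marked point, so `f rω` extends by zero to a smooth form on `X`. Stokes
  -- gives `∫ ∂̄f ∧ rω = 0`, while `∂̄f = -∑ ∂̄χ_s` turns the integral into the sum of residues.
  set f : X → ℂ := fun p => 1 - ∑ s, χ s p with hf
  have hfsmooth : ContMDiff 𝓘(ℝ, ℂ) 𝓘(ℝ, ℂ) ∞ f :=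
    contMDiff_const.sub (contMDiff_finsetSum fun s _ => hχsmooth s)
  have hf0 : ∀ t ∈ C.S, ∀ᶠ p in nhds t, f p = 0 := by
    intro t ht
    have h : ∀ s : C.S, ∀ᶠ p in nhds t, χ s p = if s = ⟨t, ht⟩ then 1 else 0 := by
      intro s
      split_ifs with hs
      · subst hs
        exact hχs _
      · exact hχt s t ht fun h => hs (Subtype.ext h.symm)
    filter_upwards [Filter.eventually_all.2 h] with p hp
    simp [hf, hp]
  have haf : ∀ k, ContMDiff 𝓘(ℝ, ℂ) 𝓘(ℝ, ℂ) ∞ fun p => a k p * f p := fun k =>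
    (contDiff_fst.mul contDiff_snd : ContDiff ℝ ∞ fun z : ℂ × ℂ => z.1 * z.2).contMDiff.comp
      ((hasmooth k).prodMk_space hfsmooth)
  have haf0 : ∀ k, ∀ t ∈ C.S, ∀ᶠ p in nhds t, a k p * f p = 0 := fun k t ht => by
    filter_upwards [hf0 t ht] with p hp
    rw [hp, mul_zero]
  have hafsupp : ∀ k, tsupport (fun p => a k p * f p) ⊆ (φ k).source := fun k =>
    (tsupport_mul_subset_left).trans (hasupp k)
  -- Since `a_k f` is supported in the chart `φ_k`, all terms can be moved to that chart, where `∑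
  -- a_j = 1` reduces the sum to the local Stokes theorem.
  have h1 : ∀ k, ∑ j, ∫ x, C.density r (φ j) (a j) (fun p => a k p * f p) x = 0 := by
    intro k
    have e : ∫ x, C.density r (φ k) (fun p => ∑ j, a j p) (fun p => a k p * f p) x = 0 := by
      simp only [hasum]
      exact integral_density_one_eq_zero hr (hφ k) (haf k) (hafsupp k) (haf0 k)
    simp only [density_sum_left] at e
    rw [MeasureTheory.integral_finsetSum _ fun j _ => integrable_density hr (hφ k) (hacont j)
      (haf k) (Set.inter_subset_right.trans (hafsupp k)) fun t ht => ⟨0, haf0 k t ht⟩] at e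
    rw [← e]
    exact Finset.sum_congr rfl fun j _ => integral_density_eq (hφ j) (hφ k) (haf k)
      (Set.inter_subset_left.trans (hasupp j)) (Set.inter_subset_right.trans (hafsupp k))
  have h2 : ∑ j, ∫ x, C.density r (φ j) (a j) f x = 0 := by
    have e : ∀ j, ∫ x, C.density r (φ j) (a j) f x =
        ∑ k, ∫ x, C.density r (φ j) (a j) (fun p => a k p * f p) x := by
      intro j
      rw [← MeasureTheory.integral_finsetSum _ fun k _ => integrable_density hr (hφ j) (hacont j)
        (haf k) (Set.inter_subset_left.trans (hasupp j)) fun t ht => ⟨0, haf0 k t ht⟩]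
      simp only [← density_sum_right Finset.univ (hφ j) (a j) haf, ← Finset.sum_mul, hasum,
        one_mul]
    simp only [e]
    rw [Finset.sum_comm]
    exact Finset.sum_eq_zero fun k _ => h1 k
  -- Likewise `χ_s` is supported in the coordinate chart at `s`, where the integral is known from
  -- `exists_cutoff`.
  have h3 : ∀ s, ∑ j, ∫ x, C.density r (φ j) (a j) (χ s) x =
      -(2 * Real.pi * (L s).coeff (-1)) := by
    intro s
    rw [← hχint s]
    have e : ∀ x, C.density r (C.coord s) (fun _ => 1) (χ s) x =
        ∑ j, C.density r (C.coord s) (a j) (χ s) x := by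
      intro x
      rw [← density_sum_left]
      simp only [hasum]
    simp only [e]
    rw [MeasureTheory.integral_finsetSum _ fun j _ => integrable_density hr (C.coord_mem s)
      (hacont j) (hχsmooth s) (Set.inter_subset_right.trans (hχsupp s)) (hχconst s)]
    exact Finset.sum_congr rfl fun j _ => integral_density_eq (hφ j) (C.coord_mem s) (hχsmooth s)
      (Set.inter_subset_left.trans (hasupp j)) (Set.inter_subset_right.trans (hχsupp s))
  have h4 : ∀ j, ∫ x, C.density r (φ j) (a j) f x =
      -∑ s, ∫ x, C.density r (φ j) (a j) (χ s) x := by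
    intro j
    rw [← MeasureTheory.integral_finsetSum _ fun s _ => integrable_density hr (hφ j) (hacont j)
      (hχsmooth s) (Set.inter_subset_left.trans (hasupp j)) (hχconst s),
      ← MeasureTheory.integral_neg]
    simp only [hf, density_const_sub,
      density_sum_right Finset.univ (hφ j) (a j) hχsmooth]
  simp only [h4, Finset.sum_neg_distrib] at h2
  rw [Finset.sum_comm] at h2
  simp only [h3, Finset.sum_neg_distrib, neg_neg, ← Finset.mul_sum] at h2
  have hpi : (2 * Real.pi : ℂ) ≠ 0 := by
    simp [Real.pi_ne_zero]
  exact (mul_eq_zero.1 h2).resolve_left hpi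

/-- The ring `R` is isotropic. -/
theorem pairing_eq_zero_of_mem_R [T2Space X] [CompactSpace X] {L M : C.K} (hL : L ∈ C.R)
    (hM : M ∈ C.R) : C.pairing L M = 0 := by
  obtain ⟨f, hf, hfL⟩ := hL
  obtain ⟨g, hg, hgM⟩ := hM
  refine sum_residues_eq_zero (r := fun p => f p * g p) (hf.mul hg) fun s => ?_
  exact ((hfL s).mul (hgM s)).mul (C.hasLaurentExpansion_formSeries s)

end MarkedCurve

end GreenKernel

end

theorem mainTheorem3 {X : Type*} [TopologicalSpace X] [T2Space X] [CompactSpace X]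
    [ConnectedSpace X] [ChartedSpace ℂ X] [IsManifold 𝓘(ℂ) ω X]
    (C : GreenKernel.MarkedCurve X) (Λ : Submodule ℂ C.K) (hΛ : C.IsLagrangianComplement Λ)
    (B : C.DualBases Λ) :
    ∃ i : C.S → C.S → PowerSeries GreenKernel.Laurent₂,
      (∀ s t, PowerSeries.constantCoeff (i s t) = 1 ∧
        ∀ k, PowerSeries.coeff k (i s t) ∈ GreenKernel.boundedLaurent₂) ∧
      (∀ s,
        PowerSeries.C (GreenKernel.inZ GreenKernel.localVar) - C.shiftedW s =
          i s s *
            (PowerSeries.C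
                (GreenKernel.inZ GreenKernel.localVar - GreenKernel.inW GreenKernel.localVar) +
              PowerSeries.C
                  ((GreenKernel.inZ GreenKernel.localVar - GreenKernel.inW GreenKernel.localVar) *
                    B.green s s) *
                B.psiGamma s s)) ∧
      (∀ s t, s ≠ t → 1 = i s t * (1 + PowerSeries.C (B.green s t) * B.psiGamma s t)) := by
  exact B.exists_factor hΛ fun f hf g hg => GreenKernel.MarkedCurve.pairing_eq_zero_of_mem_R hf hg
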